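/- Fix $\tau>0$ and $\mu\in(0,1)$. For each integer $N\ge 1$ let $m=m_N=\lfloor \tau N\rfloor$, and write the elements of $[0,\infty)^{m+1}$ as $x=(x_{-m},\dots,x_0)$. Define two maps of $[0,\infty)^{m+1}$ to itself by $(\theta_N^{\pm}(x))_j=x_{j+1}$ for $-m\le j<0$, and $$(\theta_N^{+}(x))_0=x_0\Big(1+\frac1N\Big),\qquad (\theta_N^{-}(x))_0=\max\Big\{x_0\Big(1-\frac{x_{-m}}{N^2}\Big),0\Big\}.$$ Let $(\xi^N(n))_{n\ge 0}$ be a discrete-time Markov chain on $[0,\infty)^{m+1}$ with transition probabilities $P_N(x,\cdot)=\frac12\delta_{\theta_N^-(x)}+\frac12\delta_{\theta_N^+(x)}$ and with $\xi^N_j(0)=\mu N$ for all $-m\le j\le 0$. Let $(\sigma_n)_{n\ge1}$ be i.i.d. exponential random variables with parameter $1$, independent of $\xi^N$, and put $J_0=0$, $J_n=\sigma_1+\dots+\sigma_n$. Let $X^N(t)=\xi^N(n)$ for $t\in[J_n,J_{n+1})$, $n\ge0$. Define $$Y^N(t)=\begin{cases}\dfrac{X^N_{-m}(N(t+\tau))}{N},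 & t\in[-\tau,0),\\[2mm] \dfrac{X^N_0(Nt)}{N}, & t\ge 0.\end{cases}$$ Then, for every $T>0$, there is a unique continuous function $u:[-\tau,T]\to\mathbb R$ such that $$u'(t)=\tfrac12\,u(t)\big(1-u(t-\tau)\big)\ \text{ for } t\in(0,T],\qquad u(t)=\mu\ \text{ for } t\in[-\tau,0]$$ (with the one-sided derivative at $t=T$), and, as $N\to\infty$, the processes $\{Y^N(t):t\in[-\tau,T]\}$, whose paths are almost surely càdlàg, converge in probability to $u$ in the Skorokhod ($J_1$) topology of $D([-\tau,T],\mathbb R)$. -/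

import Mathlib

open MeasureTheory ProbabilityTheory Filter Topology
open scoped NNReal ENNReal

noncomputable section

/-- A function on `[a, b]` is càdlàg if it is right-continuous and has a finite left limit at every
point (both conditions are vacuous at `b`, resp. at `a`). -/
def IsCadlag {a b : ℝ} (x : Set.Icc a b → ℝ) : Prop :=
  ∀ t, ContinuousWithinAt x (Set.Ici t) t ∧ ∃ l : ℝ, Tendsto x (𝓝[<] t) (𝓝 l)

/-- The space `D([a, b], ℝ)` of càdlàg functions on `[a, b]`. -/
def SkorokhodSpace (a b : ℝ) : Type := {x : Set.Icc a b → ℝ // IsCadlag x}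

namespace SkorokhodSpace

variable {a b : ℝ}

/-- The cost `max (sup_t |l t - t|) (sup_t |x t - y (l t)|)` of matching `x` with `y` through the
time change `l`, an increasing bijection of `[a, b]` (hence a homeomorphism). -/
def cost (x y : SkorokhodSpace a b) (l : Set.Icc a b ≃o Set.Icc a b) : ℝ≥0∞ :=
  max (⨆ t, edist (l t) t) (⨆ t, edist (x.1 t) (y.1 (l t)))

lemma cost_refl (x : SkorokhodSpace a b) : cost x x (OrderIso.refl _) = 0 := by
  simp [cost]

lemma cost_symm (x y : SkorokhodSpace a b) (l : Set.Icc a b ≃o Set.Icc a b) :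
    cost y x l.symm ≤ cost x y l := by
  refine max_le_max (iSup_le fun t => ?_) (iSup_le fun t => ?_)
  · refine le_iSup_of_le (l.symm t) ?_
    rw [l.apply_symm_apply, edist_comm]
  · refine le_iSup_of_le (l.symm t) ?_
    rw [l.apply_symm_apply, edist_comm]

lemma cost_trans (x y z : SkorokhodSpace a b) (l m : Set.Icc a b ≃o Set.Icc a b) :
    cost x z (l.trans m) ≤ cost x y l + cost y z m := by
  refine max_le (iSup_le fun t => ?_) (iSup_le fun t => ?_)
  · rw [OrderIso.trans_apply, add_comm]
    exact (edist_triangle _ (l t) _).trans (add_le_add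
      ((le_iSup (fun s => edist (m s) s) (l t)).trans (le_max_left _ _))
      ((le_iSup (fun s => edist (l s) s) t).trans (le_max_left _ _)))
  · rw [OrderIso.trans_apply]
    exact (edist_triangle _ (y.1 (l t)) _).trans (add_le_add
      ((le_iSup (fun s => edist (x.1 s) (y.1 (l s))) t).trans (le_max_right _ _))
      ((le_iSup (fun s => edist (y.1 s) (z.1 (m s))) (l t)).trans (le_max_right _ _)))

/-- The Skorokhod (J1) distance, the infimum of the costs over all time changes. Its topology is the
Skorokhod topology of `D([a, b], ℝ)`. -/
instance : PseudoEMetricSpace (SkorokhodSpace a b) where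
  edist x y := ⨅ l : Set.Icc a b ≃o Set.Icc a b, cost x y l
  edist_self x := le_antisymm (iInf_le_of_le (OrderIso.refl _) (cost_refl x).le) bot_le
  edist_comm x y := le_antisymm
    (le_iInf fun l => iInf_le_of_le l.symm (cost_symm y x l))
    (le_iInf fun l => iInf_le_of_le l.symm (cost_symm x y l))
  edist_triangle x y z := by
    rw [ENNReal.iInf_add]
    refine le_iInf fun l => ?_
    rw [ENNReal.add_iInf]
    exact le_iInf fun m => iInf_le_of_le (l.trans m) (cost_trans x y z l m)

/-- A continuous function on `[a, b]`, as an element of `D([a, b], ℝ)`. -/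
def ofContinuousOn (u : ℝ → ℝ) (hu : ContinuousOn u (Set.Icc a b)) : SkorokhodSpace a b :=
  ⟨fun t => u t, fun t =>
    have h : Continuous fun s : Set.Icc a b => u s := continuousOn_iff_continuous_domRestrict.1 hu
    ⟨h.continuousWithinAt, u t, h.continuousAt.tendsto.mono_left nhdsWithin_le_nhds⟩⟩

end SkorokhodSpace

/-- Convergence in probability in the Skorokhod topology of `D([a, b], ℝ)` of processes `Y N`, with
almost surely càdlàg paths and possibly defined on different probability spaces, to a deterministic
path `x`: for each neighbourhood `U` of `x`, the probability that the path of `Y N` is not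
an element of `U` tends to `0`. Only the processes with `1 ≤ N` matter. -/
def ConvergesInProbabilitySkorokhod {a b : ℝ} {Ω : ℕ → Type*} [∀ N, MeasurableSpace (Ω N)]
    (P : ∀ N, Measure (Ω N)) (Y : ∀ N, Ω N → Set.Icc a b → ℝ) (x : SkorokhodSpace a b) : Prop :=
  (∀ N, 1 ≤ N → ∀ᵐ ω ∂P N, IsCadlag (Y N ω)) ∧
  ∀ U ∈ 𝓝 x, Tendsto (fun N => P N {ω | ¬ ∃ y ∈ U, y.1 = Y N ω}) atTop (𝓝 0)

/-- The state space `[0, ∞) ^ (⌊τ N⌋ + 1)`. The coordinate of index `k` is the one that is written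
`x_{-k}`, the population size `k` steps in the past: index `0` is the present one, and the
last index `⌊τ N⌋` is the oldest one. -/
abbrev MemoryState (τ : ℝ) (N : ℕ) : Type := Fin (⌊τ * N⌋₊ + 1) → ℝ≥0

/-- The birth map: `x_0` becomes `x_0 (1 + 1 / N)`, and every stored value becomes one step older,
the oldest one being forgotten. -/
def birthMap (τ : ℝ) (N : ℕ) (x : MemoryState τ N) : MemoryState τ N :=
  Fin.cons (x 0 * (1 + 1 / (N : ℝ≥0))) (Fin.init x)

/-- The death map: `x_0` becomes `x_0 (1 - x_{-⌊τ N⌋} / N ^ 2) ∨ 0`, and every stored value becomes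
one step older, the oldest one being forgotten. -/
def deathMap (τ : ℝ) (N : ℕ) (x : MemoryState τ N) : MemoryState τ N :=
  Fin.cons (Real.toNNReal ((x 0 : ℝ) * (1 - (x (Fin.last _) : ℝ) / (N : ℝ) ^ 2))) (Fin.init x)

/-- The transition probability from `x`: the death and the birth map have probability `1 / 2`. -/
def transitionLaw (τ : ℝ) (N : ℕ) (x : MemoryState τ N) : Measure (MemoryState τ N) :=
  (2⁻¹ : ℝ≥0∞) • Measure.dirac (deathMap τ N x) + (2⁻¹ : ℝ≥0∞) • Measure.dirac (birthMap τ N x)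

/-- `ξ 0, ξ 1, …` is a discrete-time Markov chain with the above transition probabilities, all of
whose coordinates start at `μ N`, and `σ 0, σ 1, …` are i.i.d. exponential random variables with
parameter `1`, independent of the chain. -/
structure IsLongMemoryChain (τ μ : ℝ) (N : ℕ) {Ω : Type*} [MeasurableSpace Ω] (P : Measure Ω)
    (ξ : ℕ → Ω → MemoryState τ N) (σ : ℕ → Ω → ℝ) : Prop where
  measurable_chain : ∀ n, Measurable (ξ n)
  initial : ∀ᵐ ω ∂P, ∀ j, (ξ 0 ω j : ℝ) = μ * N
  markov : ∀ (n : ℕ) (B : Set (MemoryState τ N)), MeasurableSet B →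
    P[(ξ (n + 1) ⁻¹' B).indicator (fun _ => (1 : ℝ)) |
        ⨆ i ∈ Set.Iic n, MeasurableSpace.comap (ξ i) inferInstance]
      =ᵐ[P] fun ω => (transitionLaw τ N (ξ n ω)).real B
  measurable_clock : ∀ n, Measurable (σ n)
  law_clock : ∀ n, P.map (σ n) = expMeasure 1
  iIndep_clock : iIndepFun σ P
  indep : IndepFun (fun ω n => ξ n ω) (fun ω n => σ n ω) P

/-- The time of the `n`-th jump, the sum of the first `n` waiting times (so the `0`-th one is `0`). -/
def jumpTime {Ω : Type*} (σ : ℕ → Ω → ℝ) (n : ℕ) (ω : Ω) : ℝ := ∑ j ∈ Finset.range n, σ j ω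

/-- The continuous-time chain: its value is `ξ n` between the `n`-th and the next jump. -/
def continuousTimeChain {τ : ℝ} {N : ℕ} {Ω : Type*} (ξ : ℕ → Ω → MemoryState τ N) (σ : ℕ → Ω → ℝ)
    (t : ℝ) (ω : Ω) : MemoryState τ N :=
  ∑' n : ℕ, (Set.Ico (jumpTime σ n ω) (jumpTime σ (n + 1) ω)).indicator (fun _ => ξ n ω) t

/-- The scaled process: the present coordinate at time `N t`, divided by `N`, for `t ≥ 0`, and the
oldest coordinate at time `N (t + τ)`, divided by `N`, for `t < 0`. -/
def scaledProcess {τ : ℝ} {N : ℕ} {Ω : Type*} (ξ : ℕ → Ω → MemoryState τ N) (σ : ℕ → Ω → ℝ)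
    (t : ℝ) (ω : Ω) : ℝ :=
  if t < 0 then (continuousTimeChain ξ σ (N * (t + τ)) ω (Fin.last _) : ℝ) / N
  else (continuousTimeChain ξ σ (N * t) ω 0 : ℝ) / N

/-- `u` is a continuous solution on `[-τ, T]` of the delayed logistic equation with the constant
initial condition `μ` on `[-τ, 0]`; the derivative at the endpoint `T` is the one-sided one. Only
the values of `u` on `[-τ, T]` matter. -/
structure IsDelayedLogisticSolution (τ μ T : ℝ) (u : ℝ → ℝ) : Prop where
  continuousOn : ContinuousOn u (Set.Icc (-τ) T)
  initial : ∀ t ∈ Set.Icc (-τ) 0, u t = μ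
  equation : ∀ t ∈ Set.Ioc 0 T,
    HasDerivWithinAt u (1 / 2 * u t * (1 - u (t - τ))) (Set.Icc (-τ) T) t

end

/-! Write `A n` for the present coordinate after `n` steps divided by `N`. Averaging the birth and
death maps gives the conditional mean of the next value, so `A (n + 1) = A n + (1 / N) * (1 / 2 * A
n * (1 - A (n - m))) + noise`: an Euler scheme of step `1 / N` for the delayed logistic equation,
with delay `m / N` close to `τ` (`path_zero_div_succ`).

The path grows at most by the factor `1 + 1 / N` per step, so over `R N` steps `A` is bounded by
`exp R` without any stopping argument. Hence the unscaled noise has orthogonal increments of size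
`O(1)` and variance `O(N)`, and it is uniformly `o(N)` in probability. The same holds for `J_n - n`.
Both follow from `tendsto_measure_exists_lt_abs`: Chebyshev at a fixed number of grid points, plus a
one-sided bound on the increments to fill the gaps.

On the event that both deviations are small everything is deterministic. A discrete Gronwall
argument (`abs_sub_delayedLogistic_le`) compares `A` with the solution at the times `n / N`, and the
estimate on jump times together with the Lipschitz continuity of the solution passes to real time.
The resulting bound is uniform on `[-τ, T]`, so the identity time change gives Skorokhod
convergence.

Existence and uniqueness come from the method of steps: once the delayed term is known, the equation
is linear. -/

noncomputable section

/-! ### Method of steps: existence and uniqueness for the delay equation -/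

/-- One step of the method of steps for the delayed logistic equation. -/
def delayedLogisticStep (τ μ : ℝ) (w : ℝ → ℝ) (t : ℝ) : ℝ :=
  -- With the delayed term frozen to `w` the equation is linear, with this explicit solution; `max t
  -- 0` builds in the constant history.
  μ * Real.exp (1 / 2 * ∫ s in (0 : ℝ)..max t 0, (1 - w (s - τ)))

/-- The iterates of the method of steps; the `k`-th one is correct up to time `k τ`. -/
def delayedLogisticIterate (τ μ : ℝ) : ℕ → ℝ → ℝ
  | 0 => fun _ => μ
  | k + 1 => delayedLogisticStep τ μ (delayedLogisticIterate τ μ k)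

/-- The global solution of the delayed logistic equation with constant initial condition. -/
def delayedLogistic (τ μ t : ℝ) : ℝ := delayedLogisticIterate τ μ ⌈t / τ⌉₊ t

section DelayedLogistic

variable {τ μ : ℝ}

lemma delayedLogisticStep_of_nonpos (w : ℝ → ℝ) {t : ℝ} (ht : t ≤ 0) :
    delayedLogisticStep τ μ w t = μ := by
  simp [delayedLogisticStep, max_eq_right ht]

lemma hasDerivAt_delayedLogisticStep_aux {w : ℝ → ℝ} (hw : Continuous w) (t : ℝ) :
    HasDerivAt (fun t => μ * Real.exp (1 / 2 * ∫ s in (0 : ℝ)..t, (1 - w (s - τ))))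
      (1 / 2 * (μ * Real.exp (1 / 2 * ∫ s in (0 : ℝ)..t, (1 - w (s - τ)))) *
        (1 - w (t - τ))) t := by
  have hc : Continuous fun s => 1 - w (s - τ) := by fun_prop
  have h := (((hc.integral_hasStrictDerivAt 0 t).hasDerivAt.const_mul (1 / 2)).exp).const_mul μ
  refine h.congr_deriv ?_
  ring

lemma hasDerivAt_delayedLogisticStep {w : ℝ → ℝ} (hw : Continuous w) {t : ℝ} (ht : 0 < t) :
    HasDerivAt (delayedLogisticStep τ μ w)
      (1 / 2 * delayedLogisticStep τ μ w t * (1 - w (t - τ))) t := by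
  have h := hasDerivAt_delayedLogisticStep_aux (τ := τ) (μ := μ) hw t
  rw [delayedLogisticStep, max_eq_left ht.le]
  refine h.congr_of_eventuallyEq ?_
  filter_upwards [lt_mem_nhds ht] with s hs
  rw [delayedLogisticStep, max_eq_left hs.le]

lemma continuous_delayedLogisticStep {w : ℝ → ℝ} (hw : Continuous w) :
    Continuous (delayedLogisticStep τ μ w) := by
  have h : Continuous fun t => μ * Real.exp (1 / 2 * ∫ s in (0 : ℝ)..t, (1 - w (s - τ))) :=
    continuous_iff_continuousAt.2 fun t => (hasDerivAt_delayedLogisticStep_aux hw t).continuousAt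
  exact h.comp (continuous_id.max continuous_const)

/-- The integrand reads `w` only a time `τ` earlier. Through this causality each iteration gains an
interval of length `τ`. -/
lemma delayedLogisticStep_congr {v w : ℝ → ℝ} {R t : ℝ} (h : ∀ s ≤ R, v s = w s)
    (ht : t ≤ R + τ) (hR : 0 ≤ R + τ) :
    delayedLogisticStep τ μ v t = delayedLogisticStep τ μ w t := by
  rw [delayedLogisticStep, delayedLogisticStep]
  congr 3
  refine intervalIntegral.integral_congr fun s hs => ?_
  rw [Set.uIcc_of_le (le_max_right _ _)] at hs
  have : s ≤ R + τ := hs.2.trans (max_le ht hR)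
  rw [h _ (by linarith)]

lemma continuous_delayedLogisticIterate (k : ℕ) : Continuous (delayedLogisticIterate τ μ k) := by
  induction k with
  | zero => exact continuous_const
  | succ k ih => exact continuous_delayedLogisticStep ih

lemma delayedLogisticIterate_succ_eq (hτ : 0 < τ) (k : ℕ) {t : ℝ} (ht : t ≤ k * τ) :
    delayedLogisticIterate τ μ (k + 1) t = delayedLogisticIterate τ μ k t := by
  induction k generalizing t with
  | zero => exact delayedLogisticStep_of_nonpos _ (by simpa using ht)
  | succ k ih =>
    refine delayedLogisticStep_congr (R := k * τ) (fun s hs => ih hs) ?_ (by positivity)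
    push_cast at ht
    linarith

lemma delayedLogisticIterate_eq_of_le (hτ : 0 < τ) {k n : ℕ} (hkn : k ≤ n) {t : ℝ}
    (ht : t ≤ k * τ) : delayedLogisticIterate τ μ n t = delayedLogisticIterate τ μ k t := by
  induction n, hkn using Nat.le_induction with
  | base => rfl
  | succ n hn ih =>
    rw [delayedLogisticIterate_succ_eq hτ n, ih]
    exact ht.trans (mul_le_mul_of_nonneg_right (by exact_mod_cast hn) hτ.le)

lemma delayedLogistic_eq_iterate (hτ : 0 < τ) {k : ℕ} {t : ℝ} (ht : t ≤ k * τ) :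
    delayedLogistic τ μ t = delayedLogisticIterate τ μ k t := by
  refine (delayedLogisticIterate_eq_of_le hτ (Nat.ceil_le.2 ((div_le_iff₀ hτ).2 ht)) ?_).symm
  exact (div_le_iff₀ hτ).1 (Nat.le_ceil _)

lemma exists_lt_nat_mul (hτ : 0 < τ) (t : ℝ) : ∃ k : ℕ, t < k * τ := by
  obtain ⟨k, hk⟩ := exists_nat_gt (t / τ)
  exact ⟨k, (div_lt_iff₀ hτ).1 hk⟩

lemma continuous_delayedLogistic (hτ : 0 < τ) : Continuous (delayedLogistic τ μ) := by
  refine continuous_iff_continuousAt.2 fun t => ?_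
  obtain ⟨k, hk⟩ := exists_lt_nat_mul hτ t
  refine (continuous_delayedLogisticIterate (τ := τ) (μ := μ) k).continuousAt.congr ?_
  filter_upwards [gt_mem_nhds hk] with s hs
  exact (delayedLogistic_eq_iterate hτ hs.le).symm

/-- The fixed-point form, from which the equation, the initial condition and positivity are all read
off. -/
lemma delayedLogistic_eq_step (hτ : 0 < τ) (t : ℝ) :
    delayedLogistic τ μ t = delayedLogisticStep τ μ (delayedLogistic τ μ) t := by
  obtain ⟨k, hk⟩ := exists_lt_nat_mul hτ t
  have hk' : t ≤ k * τ + τ := by linarith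
  rw [delayedLogistic_eq_iterate (k := k + 1) hτ (by push_cast; linarith)]
  exact (delayedLogisticStep_congr (R := k * τ)
    (fun s hs => delayedLogistic_eq_iterate hτ hs) hk' (by positivity)).symm

lemma delayedLogistic_of_nonpos (hτ : 0 < τ) {t : ℝ} (ht : t ≤ 0) :
    delayedLogistic τ μ t = μ := by
  rw [delayedLogistic_eq_step hτ, delayedLogisticStep_of_nonpos _ ht]

lemma hasDerivAt_delayedLogistic (hτ : 0 < τ) {t : ℝ} (ht : 0 < t) :
    HasDerivAt (delayedLogistic τ μ)
      (1 / 2 * delayedLogistic τ μ t * (1 - delayedLogistic τ μ (t - τ))) t := by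
  have h := hasDerivAt_delayedLogisticStep (τ := τ) (μ := μ)
    (continuous_delayedLogistic (μ := μ) hτ) ht
  rwa [← funext (delayedLogistic_eq_step (μ := μ) hτ)] at h

lemma isDelayedLogisticSolution_delayedLogistic (hτ : 0 < τ) (T : ℝ) :
    IsDelayedLogisticSolution τ μ T (delayedLogistic τ μ) where
  continuousOn := (continuous_delayedLogistic hτ).continuousOn
  initial _ ht := delayedLogistic_of_nonpos hτ ht.2
  equation _ ht := (hasDerivAt_delayedLogistic hτ ht.1).hasDerivWithinAt

/-- On an interval `[0, b]` where the delayed terms agree, two solutions agree. -/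
lemma IsDelayedLogisticSolution.eqOn_step {T b : ℝ} (hτ : 0 < τ) {u v : ℝ → ℝ}
    (hu : IsDelayedLogisticSolution τ μ T u) (hv : IsDelayedLogisticSolution τ μ T v)
    (huc : Continuous u) (hpos : ∀ t, u t ≠ 0) (hbT : b ≤ T)
    (h : ∀ s ∈ Set.Icc (-τ) (b - τ), v s = u s) :
    ∀ t ∈ Set.Icc (-τ) b, v t = u t := by
  intro t ht
  rcases le_or_gt t 0 with ht0 | ht0
  · rw [hv.initial t ⟨ht.1, ht0⟩, hu.initial t ⟨ht.1, ht0⟩]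
  -- When the delayed terms agree, `u` and `v` solve the same linear equation, so their quotient is
  -- constant.
  have hd : ∀ s ∈ Set.Ioo 0 t, HasDerivAt (fun s => v s / u s) 0 s := by
    intro s hs
    have hsT : s < T := hs.2.trans_le (ht.2.trans hbT)
    have hn : Set.Icc (-τ) T ∈ 𝓝 s := Icc_mem_nhds (by linarith [hs.1]) hsT
    have h1 := (hu.equation s ⟨hs.1, hsT.le⟩).hasDerivAt hn
    have h2 := (hv.equation s ⟨hs.1, hsT.le⟩).hasDerivAt hn
    rw [h (s - τ) ⟨by linarith [hs.1], by linarith [hs.2, ht.2]⟩] at h2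
    refine (h2.div h1 (hpos s)).congr_deriv ?_
    ring
  have hc : ContinuousOn (fun s => v s / u s) (Set.Icc 0 t) :=
    (hv.continuousOn.mono (Set.Icc_subset_Icc (by linarith) (ht.2.trans hbT))).div
      huc.continuousOn fun s _ => hpos s
  obtain ⟨c, -, hc'⟩ := exists_hasDerivAt_eq_slope (fun s => v s / u s) (fun _ => 0) ht0 hc hd
  have h0 : v 0 / u 0 = 1 := by
    rw [hv.initial 0 ⟨by linarith, le_rfl⟩, ← hu.initial 0 ⟨by linarith, le_rfl⟩,
      div_self (hpos 0)]
  have hne : t - 0 ≠ 0 := by simpa using ht0.ne'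
  have h1 : v t / u t = 1 := by
    have := (div_eq_zero_iff.1 hc'.symm).resolve_right hne
    linarith
  exact (div_eq_one_iff_eq (hpos t)).1 h1

lemma delayedLogistic_pos (hτ : 0 < τ) (hμ : 0 < μ) (t : ℝ) : 0 < delayedLogistic τ μ t := by
  rw [delayedLogistic_eq_step hτ]
  exact mul_pos hμ (Real.exp_pos _)

lemma IsDelayedLogisticSolution.eqOn_delayedLogistic (hτ : 0 < τ) (hμ : 0 < μ) {T : ℝ}
    {v : ℝ → ℝ} (hv : IsDelayedLogisticSolution τ μ T v) :
    Set.EqOn v (delayedLogistic τ μ) (Set.Icc (-τ) T) := by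
  have key : ∀ k : ℕ, ∀ t ∈ Set.Icc (-τ) (min (k * τ) T), v t = delayedLogistic τ μ t := by
    intro k
    induction k with
    | zero =>
      intro t ht
      have h0 : t ≤ 0 := by simpa using ht.2.trans (min_le_left _ _)
      rw [hv.initial t ⟨ht.1, h0⟩, delayedLogistic_of_nonpos hτ h0]
    | succ k ih =>
      refine (isDelayedLogisticSolution_delayedLogistic hτ T).eqOn_step hτ hv
        (continuous_delayedLogistic hτ) (fun t => (delayedLogistic_pos hτ hμ t).ne')
        (min_le_right _ _) fun s hs => ih s ⟨hs.1, le_min ?_ ?_⟩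
      · have := hs.2.trans (sub_le_sub_right (min_le_left _ _) _)
        push_cast at this
        linarith
      · have := hs.2.trans (sub_le_sub_right (min_le_right _ _) _)
        linarith
  intro t ht
  obtain ⟨k, hk⟩ := exists_lt_nat_mul hτ T
  exact key k t ⟨ht.1, le_min (ht.2.trans hk.le) ht.2⟩

lemma delayedLogistic_le (hτ : 0 < τ) (hμ : 0 < μ) {R : ℝ} :
    ∃ C, 0 < C ∧ ∀ t ≤ R, delayedLogistic τ μ t ≤ C := by
  obtain ⟨C, hC⟩ := (isCompact_Icc (a := (0 : ℝ)) (b := R)).bddAbove_image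
    (continuous_delayedLogistic (μ := μ) hτ).continuousOn
  refine ⟨max C μ, lt_max_of_lt_right hμ, fun t ht => ?_⟩
  rcases le_or_gt t 0 with h | h
  · exact (delayedLogistic_of_nonpos hτ h).le.trans (le_max_right _ _)
  · exact (hC ⟨t, ⟨h.le, ht⟩, rfl⟩).trans (le_max_left _ _)

end DelayedLogistic

/-! ### Stability: perturbed Euler schemes for the delay equation -/

/-- Mean value theorem. Derivatives are required only in the open interval because the solution may
have a kink at `0`. -/
lemma abs_sub_sub_le_of_hasDerivAt {f f' : ℝ → ℝ} {a b c M : ℝ} (hab : a ≤ b)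
    (hf : ContinuousOn f (Set.Icc a b)) (hd : ∀ s ∈ Set.Ioo a b, HasDerivAt f (f' s) s)
    (hM : ∀ s ∈ Set.Ioo a b, |f' s - c| ≤ M) :
    |f b - f a - c * (b - a)| ≤ M * (b - a) := by
  rcases hab.eq_or_lt with rfl | hab
  · simp
  obtain ⟨s, hs, h⟩ := exists_hasDerivAt_eq_slope f f' hab hf hd
  have hba : 0 < b - a := sub_pos.2 hab
  rw [eq_div_iff hba.ne'] at h
  rw [← h, ← sub_mul, abs_mul, abs_of_pos hba]
  exact mul_le_mul_of_nonneg_right (hM s hs) hba.le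

lemma abs_logistic_sub_le {C a b a' b' : ℝ} (ha' : |a'| ≤ C) (hb0 : 0 ≤ b) (hb : b ≤ C) :
    |1 / 2 * a * (1 - b) - 1 / 2 * a' * (1 - b')| ≤
      1 / 2 * (1 + C) * |a - a'| + 1 / 2 * C * |b - b'| := by
  have h : 1 / 2 * a * (1 - b) - 1 / 2 * a' * (1 - b') =
      1 / 2 * (1 - b) * (a - a') + 1 / 2 * a' * (b' - b) := by ring
  have h1 : |1 - b| ≤ 1 + C := abs_le.2 ⟨by linarith, by linarith⟩
  rw [h]
  refine (abs_add_le _ _).trans ?_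
  rw [abs_mul, abs_mul, abs_mul, abs_mul, abs_sub_comm b' b, abs_of_pos (by norm_num : (0:ℝ) < 1/2)]
  gcongr

section DelayedLogistic

variable {τ μ : ℝ}

lemma delayedLogistic_max_zero (hτ : 0 < τ) (t : ℝ) :
    delayedLogistic τ μ (max t 0) = delayedLogistic τ μ t := by
  rcases le_total t 0 with h | h
  · rw [max_eq_right h, delayedLogistic_of_nonpos hτ h, delayedLogistic_of_nonpos hτ le_rfl]
  · rw [max_eq_left h]

lemma abs_delayedLogistic_sub_le (hτ : 0 < τ) (hμ : 0 < μ) {R C : ℝ} (hR : 0 ≤ R)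
    (hC : ∀ t ≤ R, delayedLogistic τ μ t ≤ C) {s t : ℝ} (hs : s ≤ R) (ht : t ≤ R) :
    |delayedLogistic τ μ s - delayedLogistic τ μ t| ≤ 1 / 2 * C * (1 + C) * |s - t| := by
  have key : ∀ a b : ℝ, 0 ≤ a → a ≤ b → b ≤ R →
      |delayedLogistic τ μ b - delayedLogistic τ μ a| ≤ 1 / 2 * C * (1 + C) * (b - a) := by
    intro a b ha hab hb
    have := abs_sub_sub_le_of_hasDerivAt (c := 0) (M := 1 / 2 * C * (1 + C)) hab
      (continuous_delayedLogistic (μ := μ) hτ).continuousOn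
      (fun s hs => hasDerivAt_delayedLogistic hτ (ha.trans_lt hs.1)) fun s hs => ?_
    · simpa using this
    · have h0 := delayedLogistic_pos hτ hμ s
      have h0' := delayedLogistic_pos hτ hμ (s - τ)
      have h1 := hC s (by linarith [hs.2])
      have h2 := hC (s - τ) (by linarith [hs.2])
      have hC1 : 0 ≤ C := h0.le.trans h1
      have h3 : |1 - delayedLogistic τ μ (s - τ)| ≤ 1 + C := abs_le.2 ⟨by linarith, by linarith⟩
      rw [sub_zero, abs_mul, abs_of_nonneg (by positivity)]
      gcongr
  have hC0 : 0 ≤ C := (delayedLogistic_pos hτ hμ 0).le.trans (hC 0 hR)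
  have key' : ∀ a b : ℝ, a ≤ b → b ≤ R →
      |delayedLogistic τ μ b - delayedLogistic τ μ a| ≤ 1 / 2 * C * (1 + C) * (b - a) := by
    intro a b hab hb
    -- The history is constant and truncation at `0` is 1-Lipschitz, so the bound on nonnegative
    -- times suffices.
    rw [← delayedLogistic_max_zero hτ a, ← delayedLogistic_max_zero hτ b]
    refine (key _ _ (le_max_right _ _) (max_le_max_right _ hab) (max_le hb hR)).trans ?_
    refine mul_le_mul_of_nonneg_left ?_ (by positivity)
    have := abs_max_sub_max_le_abs b a 0
    rw [abs_of_nonneg (sub_nonneg.2 hab)] at this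
    exact (le_abs_self _).trans this
  rcases le_total s t with h | h
  · rw [abs_sub_comm, abs_sub_comm s, abs_of_nonneg (sub_nonneg.2 h)]
    exact key' s t h ht
  · rw [abs_of_nonneg (sub_nonneg.2 h)]
    exact key' t s h hs

/-- The error of one Euler step, with the delay perturbed by at most the step size. -/
lemma abs_delayedLogistic_euler_step_le (hτ : 0 < τ) (hμ : 0 < μ) {R C : ℝ} (hR : 0 ≤ R)
    (hC : ∀ t ≤ R, delayedLogistic τ μ t ≤ C) {a d h : ℝ} (ha : 0 ≤ a) (hh : 0 ≤ h)
    (hah : a + h ≤ R) (hda : d ≤ a) (hd : |d - (a - τ)| ≤ h) :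
    |delayedLogistic τ μ (a + h) - delayedLogistic τ μ a -
        1 / 2 * delayedLogistic τ μ a * (1 - delayedLogistic τ μ d) * h| ≤
      1 / 4 * C * (1 + C) * (1 + 3 * C) * h * h := by
  have hC0 : 0 ≤ C := (delayedLogistic_pos hτ hμ 0).le.trans (hC 0 hR)
  have := abs_sub_sub_le_of_hasDerivAt
    (c := 1 / 2 * delayedLogistic τ μ a * (1 - delayedLogistic τ μ d))
    (M := 1 / 4 * C * (1 + C) * (1 + 3 * C) * h) (le_add_of_nonneg_right hh : a ≤ a + h)
    (continuous_delayedLogistic (μ := μ) hτ).continuousOn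
    (fun s hs => hasDerivAt_delayedLogistic hτ (ha.trans_lt hs.1)) fun s hs => ?_
  · simpa using this
  have hsR : s ≤ R := hs.2.le.trans hah
  have haR : a ≤ R := by linarith
  have h0 := delayedLogistic_pos hτ hμ a
  refine (abs_logistic_sub_le (C := C) ?_ (delayedLogistic_pos hτ hμ _).le
    (hC _ (by linarith))).trans ?_
  · rw [abs_of_pos h0]
    exact hC _ haR
  have h1 : |s - a| ≤ h := abs_le.2 ⟨by linarith [hs.1], by linarith [hs.2]⟩
  have h2 : |s - τ - d| ≤ 2 * h := by
    rw [abs_le] at hd ⊢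
    constructor <;> linarith [hs.1, hs.2, hd.1, hd.2]
  have h3 := abs_delayedLogistic_sub_le hτ hμ hR hC hsR haR
  have h4 := abs_delayedLogistic_sub_le hτ hμ hR hC (by linarith : s - τ ≤ R)
    (hda.trans haR)
  -- With the Lipschitz constant `L = C (1 + C) / 2`, the total is `L h ((1 + C) + 2 C) / 2`, whence
  -- the factor `1 + 3 C`.
  calc _ ≤ 1 / 2 * (1 + C) * (1 / 2 * C * (1 + C) * h) +
        1 / 2 * C * (1 / 2 * C * (1 + C) * (2 * h)) := by
        gcongr
        · exact h3.trans (by gcongr)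
        · exact h4.trans (by gcongr)
    _ = _ := by ring

/-- A perturbed Euler scheme stays close to the solution of the delayed logistic equation. -/
lemma abs_sub_delayedLogistic_le (hτ : 0 < τ) (hμ : 0 < μ) {R C ε h : ℝ} (hR : 0 ≤ R)
    (hC : ∀ t ≤ R, delayedLogistic τ μ t ≤ C) (hε : 0 ≤ ε) (hh : 0 < h) {m M : ℕ}
    (hm : m * h ≤ τ) (hm' : τ ≤ m * h + h) (hM : M * h ≤ R)
    {A X : ℕ → ℝ} (hA0 : A 0 = μ) (hX0 : X 0 = 0)
    (hA : ∀ n ≤ M, 0 ≤ A n ∧ A n ≤ C) (hX : ∀ n ≤ M, |X n| ≤ ε)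
    (hrec : ∀ n < M, A (n + 1) = A n + h * (1 / 2 * A n * (1 - A (n - m))) + (X (n + 1) - X n)) :
    ∀ n ≤ M, |A n - delayedLogistic τ μ (n * h)| ≤
      (ε + h * (1 / 4 * C * (1 + C) * (1 + 3 * C))) * Real.exp ((3 / 2 + C) * R) := by
  set u := delayedLogistic τ μ with hu
  have hC0 : 0 ≤ C := (delayedLogistic_pos hτ hμ 0).le.trans (hC 0 hR)
  set K := 1 / 4 * C * (1 + C) * (1 + 3 * C) with hK
  have hK0 : 0 ≤ K := by positivity
  -- The growth rate `3 / 2 + C` is `1 / 2 + C` from the Lipschitz bound on the drift, plus `1` to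
  -- absorb the local error `K h ^ 2 ≤ h * g n`.
  set g : ℕ → ℝ := fun n => (ε + h * K) * (1 + h * (3 / 2 + C)) ^ n with hg
  have hgmono : Monotone g := fun i j hij => by
    refine mul_le_mul_of_nonneg_left (pow_le_pow_right₀ ?_ hij) (by positivity)
    have : 0 ≤ h * (3 / 2 + C) := by positivity
    linarith
  have hg0 : ∀ n, ε + h * K ≤ g n := fun n => by
    simpa [hg] using hgmono (Nat.zero_le n)
  have hdiff : ∀ n ≤ M, |A n - u (n * h) - X n| + ε ≤ g n → |A n - u (n * h)| ≤ g n := by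
    intro n hn h1
    have h2 := hX n hn
    rw [abs_le] at h2 ⊢
    have h3 := abs_le.1 (le_sub_iff_add_le.2 h1)
    constructor <;> linarith [h3.1, h3.2, h2.1, h2.2]
  -- Subtracting `X n` makes the noise increments telescope, so only the bound `ε` on `|X|` enters,
  -- not the sum of the increments.
  have key : ∀ n ≤ M, |A n - u (n * h) - X n| + ε ≤ g n := by
    intro n
    induction n using Nat.strong_induction_on with
    | _ n ih =>
      intro hn
      rcases n with _ | n
      · simp only [Nat.cast_zero, zero_mul, hA0, hX0, hu, delayedLogistic_of_nonpos hτ le_rfl]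
        simpa using (le_add_of_nonneg_right (by positivity)).trans (hg0 0)
      have hnM : n ≤ M := (Nat.le_succ n).trans hn
      have h1 := ih n (Nat.lt_succ_self n) hnM
      have h2 := ih (n - m) (by omega) (by omega)
      have h1' := hdiff n hnM h1
      have h2' := (hdiff (n - m) (by omega) h2).trans (hgmono (Nat.sub_le n m))
      -- Truncated subtraction is harmless: for `n ≤ m` both sides are the initial value `μ`.
      have hdelay : u (((n - m : ℕ) : ℝ) * h) = u (n * h - m * h) := by
        rcases le_total m n with hmn | hmn
        · rw [Nat.cast_sub hmn, sub_mul]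
        · rw [Nat.sub_eq_zero_of_le hmn, hu, delayedLogistic_of_nonpos hτ (by simp),
            delayedLogistic_of_nonpos hτ]
          exact sub_nonpos.2 (mul_le_mul_of_nonneg_right (by exact_mod_cast hmn) hh.le)
      rw [hdelay] at h2'
      have hnR : ((n + 1 : ℕ) : ℝ) * h ≤ R :=
        (mul_le_mul_of_nonneg_right (by exact_mod_cast hn) hh.le).trans hM
      push_cast at hnR
      have hmh : 0 ≤ (m : ℝ) * h := by positivity
      have hstep := abs_delayedLogistic_euler_step_le hτ hμ hR hC (a := n * h)
        (d := n * h - m * h) (by positivity) hh.le (by linarith) (by linarith)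
        (abs_le.2 ⟨by linarith, by linarith⟩)
      rw [← hu, ← hK] at hstep
      have hAb := hA (n - m) (by omega)
      have hF := abs_logistic_sub_le (C := C) (a := A n) (a' := u (n * h))
        (b := A (n - m)) (b' := u (n * h - m * h))
        (by rw [abs_of_pos (delayedLogistic_pos hτ hμ _)]; exact hC _ (by linarith)) hAb.1 hAb.2
      have hF' : |1 / 2 * A n * (1 - A (n - m)) -
          1 / 2 * u (n * h) * (1 - u (n * h - m * h))| ≤ (1 / 2 + C) * g n := by
        refine hF.trans ?_
        calc _ ≤ 1 / 2 * (1 + C) * g n + 1 / 2 * C * g n := by gcongr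
          _ = _ := by ring
      have hsplit : A (n + 1) - u (((n + 1 : ℕ) : ℝ) * h) - X (n + 1) =
          (A n - u (n * h) - X n) + h * (1 / 2 * A n * (1 - A (n - m)) -
            1 / 2 * u (n * h) * (1 - u (n * h - m * h))) -
          (u (n * h + h) - u (n * h) - 1 / 2 * u (n * h) * (1 - u (n * h - m * h)) * h) := by
        rw [hrec n hn]
        push_cast
        rw [add_mul, one_mul]
        ring
      rw [hsplit]
      have hs1 := abs_sub ((A n - u (n * h) - X n) + h * (1 / 2 * A n * (1 - A (n - m)) -
            1 / 2 * u (n * h) * (1 - u (n * h - m * h))))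
          (u (n * h + h) - u (n * h) - 1 / 2 * u (n * h) * (1 - u (n * h - m * h)) * h)
      have hs2 := abs_add_le (A n - u (n * h) - X n) (h * (1 / 2 * A n * (1 - A (n - m)) -
            1 / 2 * u (n * h) * (1 - u (n * h - m * h))))
      rw [abs_mul h, abs_of_pos hh] at hs2
      have hs3 := mul_le_mul_of_nonneg_left hF' hh.le
      have hs4 : K * h * h ≤ h * g n := by
        have := mul_le_mul_of_nonneg_left ((le_add_of_nonneg_left hε).trans (hg0 n)) hh.le
        linarith
      have hs5 : g (n + 1) = g n + h * ((1 / 2 + C) * g n) + h * g n := by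
        simp only [hg, pow_succ]
        ring
      linarith
  intro n hn
  refine (hdiff n hn (key n hn)).trans ?_
  refine mul_le_mul_of_nonneg_left ?_ (by positivity)
  have h1 : 1 + h * (3 / 2 + C) ≤ Real.exp (h * (3 / 2 + C)) := by
    linarith [Real.add_one_le_exp (h * (3 / 2 + C))]
  refine (pow_le_pow_left₀ (by positivity) h1 n).trans ?_
  rw [← Real.exp_nat_mul]
  refine Real.exp_le_exp.2 ?_
  have : (n : ℝ) * h ≤ R := (mul_le_mul_of_nonneg_right (by exact_mod_cast hn) hh.le).trans hM
  calc (n : ℝ) * (h * (3 / 2 + C)) = (3 / 2 + C) * (n * h) := by ring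
    _ ≤ _ := by gcongr

end DelayedLogistic

/-! ### Uniform control from finitely many grid points -/

section Grid

/-- A sequence whose decrements are at most `c` is controlled by its values on a grid. -/
lemma abs_le_of_abs_grid_le {X : ℕ → ℝ} {M I : ℕ} {c η : ℝ} (hI : 0 < I) (hc : 0 ≤ c)
    (hstep : ∀ n < M, X n - c ≤ X (n + 1))
    (hgrid : ∀ i ≤ I, |X (min (i * (M / I + 1)) M)| ≤ η) {n : ℕ} (hn : n ≤ M) :
    |X n| ≤ η + c * (M / I + 1) := by
  have hmono : ∀ a b : ℕ, a ≤ b → b ≤ M → X a - c * (b - a) ≤ X b := by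
    intro a b hab
    induction b, hab using Nat.le_induction with
    | base => intro _; simp
    | succ b _ ih =>
      intro hb
      have h1 := ih (by omega)
      have h2 := hstep b (by omega)
      push_cast
      linarith
  set q := M / I + 1 with hq
  have hq0 : 0 < q := Nat.succ_pos _
  have hqr : (q : ℝ) ≤ M / I + 1 := by
    rw [hq]
    push_cast
    gcongr
    exact Nat.cast_div_le
  have hMI : M < I * q := Nat.lt_mul_div_succ M hI
  have hi : n / q < I := Nat.div_lt_of_lt_mul (by rw [mul_comm]; omega)
  have h1 : n / q * q ≤ n := Nat.div_mul_le_self n q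
  have h2 : n < (n / q + 1) * q := by
    rw [add_mul, one_mul]
    exact Nat.lt_div_mul_add hq0
  -- `n` lies between two consecutive grid points (the last ones clipped at `M`). The left one
  -- bounds `X n` from below and the right one from above, as `X` cannot fall by more than `c` per
  -- step.
  have ha := abs_le.1 (hgrid (n / q) hi.le)
  have hb := abs_le.1 (hgrid (n / q + 1) hi)
  rw [min_eq_left (h1.trans hn)] at ha
  have h3 := hmono _ _ h1 hn
  have h4 := hmono n (min ((n / q + 1) * q) M) (le_min h2.le hn) (min_le_right _ _)
  have e1 : (n : ℝ) - (n / q * q : ℕ) ≤ M / I + 1 := by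
    refine le_trans ?_ hqr
    rw [sub_le_iff_le_add]
    rw [add_mul, one_mul] at h2
    exact_mod_cast (by omega : n ≤ q + n / q * q)
  have e2 : ((min ((n / q + 1) * q) M : ℕ) : ℝ) - n ≤ M / I + 1 := by
    refine le_trans ?_ hqr
    rw [sub_le_iff_le_add]
    rw [add_mul, one_mul]
    exact_mod_cast (by omega : min (n / q * q + q) M ≤ q + n)
  have e1' := mul_le_mul_of_nonneg_left e1 hc
  have e2' := mul_le_mul_of_nonneg_left e2 hc
  exact abs_le.2 ⟨by linarith [ha.1], by linarith [hb.2]⟩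

lemma measure_exists_lt_abs_le {Ω : Type*} [MeasurableSpace Ω] {P : Measure Ω} {X : ℕ → Ω → ℝ}
    {M I : ℕ} {c η : ℝ} {B : ℝ≥0∞} (hI : 0 < I) (hc : 0 ≤ c)
    (hstep : ∀ᵐ ω ∂P, ∀ n < M, X n ω - c ≤ X (n + 1) ω)
    (hB : ∀ n ≤ M, P {ω | η ≤ |X n ω|} ≤ B) :
    P {ω | ∃ n ≤ M, η + c * (M / I + 1) < |X n ω|} ≤ (I + 1 : ℕ) * B := by
  calc P {ω | ∃ n ≤ M, η + c * (M / I + 1) < |X n ω|}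
      ≤ P (⋃ i ∈ Finset.range (I + 1), {ω | η ≤ |X (min (i * (M / I + 1)) M) ω|}) := by
        refine measure_mono_ae ?_
        filter_upwards [hstep] with ω hω hex
        obtain ⟨n, hn, hlt⟩ := hex
        by_contra hcon
        refine hlt.not_ge (abs_le_of_abs_grid_le (X := fun n => X n ω) hI hc hω (fun i hi => ?_) hn)
        by_contra hi'
        refine hcon (Set.mem_iUnion₂.2 ⟨i, ?_, (not_le.1 hi').le⟩)
        exact Finset.mem_range.2 (Nat.lt_succ_of_le hi)
    _ ≤ ∑ i ∈ Finset.range (I + 1), P {ω | η ≤ |X (min (i * (M / I + 1)) M) ω|} :=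
        measure_biUnion_finset_le _ _
    _ ≤ ∑ _i ∈ Finset.range (I + 1), B := Finset.sum_le_sum fun i _ => hB _ (min_le_right _ _)
    _ = _ := by simp

/-- Processes with decrements bounded by `c` and variances growing at most linearly are `o(N)` in
probability, uniformly over `O(N)` steps. -/
lemma tendsto_measure_exists_lt_abs {Ω : ℕ → Type*} [∀ N, MeasurableSpace (Ω N)]
    {P : ∀ N, Measure (Ω N)} {X : ∀ N, ℕ → Ω N → ℝ} {M : ℕ → ℕ} {K c V ε : ℝ}
    (hc : 0 ≤ c) (hV : 0 ≤ V) (hM : ∀ N, (M N : ℝ) ≤ K * N)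
    (hstep : ∀ᶠ N in atTop, ∀ᵐ ω ∂P N, ∀ n < M N, X N n ω - c ≤ X N (n + 1) ω)
    (hB : ∀ᶠ N in atTop, ∀ n ≤ M N, ∀ η > 0,
      P N {ω | η ≤ |X N n ω|} ≤ ENNReal.ofReal (V * n / η ^ 2)) (hε : 0 < ε) :
    Tendsto (fun N => P N {ω | ∃ n ≤ M N, ε * N < |X N n ω|}) atTop (𝓝 0) := by
  have hK : 0 ≤ K := by simpa using (Nat.cast_nonneg _).trans (hM 1)
  -- `I` does not depend on `N` and makes the oscillation `c * M / I` at most `ε N / 4`. The `I + 1`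
  -- Chebyshev bounds are each `O(1 / N)`.
  obtain ⟨I, hI⟩ := exists_nat_gt (c * K / (ε / 4))
  have hI0 : (0 : ℝ) < I := lt_of_le_of_lt (by positivity) hI
  rw [div_lt_iff₀ (by positivity)] at hI
  have hlim : Tendsto (fun N : ℕ => ((I + 1 : ℕ) : ℝ≥0∞) *
      ENNReal.ofReal (V * K * 4 / ε ^ 2 * (1 / (N : ℝ)))) atTop (𝓝 0) := by
    have h1 := (tendsto_const_div_atTop_nhds_zero_nat (1 : ℝ)).const_mul (V * K * 4 / ε ^ 2)
    rw [mul_zero] at h1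
    have h2 := ENNReal.tendsto_ofReal h1
    have h3 := ENNReal.Tendsto.const_mul h2 (Or.inr (ENNReal.natCast_ne_top (I + 1)))
    simpa using h3
  obtain ⟨N₀, hN₀⟩ := exists_nat_gt (c / (ε / 4))
  rw [div_lt_iff₀ (by positivity)] at hN₀
  refine tendsto_of_tendsto_of_tendsto_of_le_of_le' tendsto_const_nhds hlim
    (Eventually.of_forall fun _ => zero_le) ?_
  filter_upwards [hstep, hB, eventually_ge_atTop N₀, eventually_gt_atTop 0] with N h1 h2 h3 h4
  have hN : (0 : ℝ) < N := by exact_mod_cast h4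
  have hN3 : (N₀ : ℝ) ≤ N := by exact_mod_cast h3
  refine le_trans (measure_mono ?_) (measure_exists_lt_abs_le (I := I) (η := ε * N / 2)
    (by exact_mod_cast hI0) hc h1 fun n hn => (h2 n hn _ (by positivity)).trans
      (ENNReal.ofReal_le_ofReal ?_))
  · rintro ω ⟨n, hn, hlt⟩
    refine ⟨n, hn, lt_of_le_of_lt ?_ hlt⟩
    have e1 : c * (M N / I) ≤ ε * N / 4 := by
      rw [← mul_div_assoc, div_le_iff₀ hI0]
      calc c * M N ≤ c * (K * N) := mul_le_mul_of_nonneg_left (hM N) hc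
        _ = c * K * N := by ring
        _ ≤ I * (ε / 4) * N := by gcongr
        _ = _ := by ring
    have e2 : c ≤ ε * N / 4 := by
      have := mul_le_mul_of_nonneg_right hN3 (by positivity : 0 ≤ ε / 4)
      linarith
    linarith
  · have hn' : (n : ℝ) ≤ K * N := le_trans (by exact_mod_cast hn) (hM N)
    calc V * n / (ε * N / 2) ^ 2 ≤ V * (K * N) / (ε * N / 2) ^ 2 := by gcongr
      _ = _ := by field_simp; norm_num

end Grid

/-! ### Exponential waiting times and the law of large numbers for jump times -/

section Exponential

lemma measurable_gammaPDF_one_one : Measurable (gammaPDF 1 1) :=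
  (measurable_gammaPDFReal 1 1).ennreal_ofReal

lemma ae_expMeasure_pos : ∀ᵐ x ∂expMeasure 1, 0 < x := by
  rw [expMeasure, gammaMeasure, ae_withDensity_iff measurable_gammaPDF_one_one]
  filter_upwards [Measure.ae_ne volume (0 : ℝ)] with x hx h
  by_contra hneg
  exact h (gammaPDF_of_neg (lt_of_le_of_ne (not_lt.1 hneg) hx))

lemma gammaPDF_one_one_toReal (x : ℝ) :
    (gammaPDF 1 1 x).toReal = (Set.Ici 0).indicator (fun x => Real.exp (-x)) x := by
  rw [gammaPDF, ENNReal.toReal_ofReal (gammaPDFReal_nonneg one_pos one_pos x), gammaPDFReal]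
  by_cases hx : 0 ≤ x <;> simp [hx]

lemma integrable_pow_expMeasure (k : ℕ) : Integrable (fun x => x ^ k) (expMeasure 1) := by
  rw [expMeasure, gammaMeasure, integrable_withDensity_iff measurable_gammaPDF_one_one
    (Eventually.of_forall fun _ => by simp [gammaPDF])]
  have h := Real.GammaIntegral_convergent (s := k + 1) (by positivity)
  rw [← integrableOn_Ici_iff_integrableOn_Ioi, ← integrable_indicator_iff measurableSet_Ici] at h
  refine h.congr (Eventually.of_forall fun x => ?_)
  simp only [gammaPDF_one_one_toReal]
  by_cases hx : x ∈ Set.Ici (0 : ℝ)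
  · simp [hx, mul_comm]
  · simp [hx]

lemma integral_id_expMeasure : ∫ x, x ∂expMeasure 1 = 1 := by
  rw [expMeasure, gammaMeasure, integral_withDensity_eq_integral_toReal_smul
    measurable_gammaPDF_one_one (Eventually.of_forall fun _ => by simp [gammaPDF])]
  have h := Real.Gamma_eq_integral (s := 2) two_pos
  rw [Real.Gamma_two, ← integral_Ici_eq_integral_Ioi, ← integral_indicator measurableSet_Ici] at h
  refine Eq.trans ?_ h.symm
  congr 1 with x
  rw [gammaPDF_one_one_toReal]
  by_cases hx : x ∈ Set.Ici (0 : ℝ)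
  · norm_num [hx]
  · simp [hx]

lemma memLp_id_expMeasure : MemLp (fun x => x) 2 (expMeasure 1) :=
  (memLp_two_iff_integrable_sq measurable_id.aestronglyMeasurable).2 (integrable_pow_expMeasure 2)

end Exponential

section JumpTime

variable {Ω : Type*} [MeasurableSpace Ω] {P : Measure Ω} {σ : ℕ → Ω → ℝ}

lemma ae_clock_pos (hm : ∀ n, Measurable (σ n)) (hl : ∀ n, P.map (σ n) = expMeasure 1) :
    ∀ᵐ ω ∂P, ∀ n, 0 < σ n ω := by
  refine ae_all_iff.2 fun n => ?_
  refine ae_of_ae_map (hm n).aemeasurable (p := fun x => 0 < x) ?_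
  rw [hl n]
  exact ae_expMeasure_pos

lemma memLp_clock (hm : ∀ n, Measurable (σ n)) (hl : ∀ n, P.map (σ n) = expMeasure 1) (n : ℕ) :
    MemLp (σ n) 2 P := by
  have h := memLp_id_expMeasure
  rw [← hl n] at h
  exact h.comp_of_map (hm n).aemeasurable

lemma integral_clock (hm : ∀ n, Measurable (σ n)) (hl : ∀ n, P.map (σ n) = expMeasure 1) (n : ℕ) :
    ∫ ω, σ n ω ∂P = 1 := by
  rw [← integral_id_expMeasure, ← hl n]
  exact (integral_map (f := fun x => x) (hm n).aemeasurable measurable_id.aestronglyMeasurable).symm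

lemma variance_clock (hm : ∀ n, Measurable (σ n)) (hl : ∀ n, P.map (σ n) = expMeasure 1) (n : ℕ) :
    Var[σ n; P] = Var[fun x => x; expMeasure 1] := by
  rw [← hl n]
  exact (variance_map (X := fun x => x) measurable_id.aemeasurable (hm n).aemeasurable).symm

variable [IsProbabilityMeasure P]

lemma measure_le_abs_jumpTime_sub_le (hm : ∀ n, Measurable (σ n))
    (hl : ∀ n, P.map (σ n) = expMeasure 1) (hi : iIndepFun σ P) (n : ℕ) {η : ℝ} (hη : 0 < η) :
    P {ω | η ≤ |jumpTime σ n ω - n|} ≤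
      ENNReal.ofReal (Var[fun x => x; expMeasure 1] * n / η ^ 2) := by
  have hJ : jumpTime σ n = ∑ j ∈ Finset.range n, σ j := by
    ext ω
    simp [jumpTime]
  have hL : MemLp (jumpTime σ n) 2 P := by
    rw [hJ]
    exact memLp_finsetSum' _ fun j _ => memLp_clock hm hl j
  have hE : ∫ ω, jumpTime σ n ω ∂P = n := by
    simp only [jumpTime]
    rw [integral_finsetSum _ fun j _ => (memLp_clock hm hl j).integrable (by norm_num)]
    simp [integral_clock hm hl]
  have hVar : Var[jumpTime σ n; P] = Var[fun x => x; expMeasure 1] * n := by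
    rw [hJ, IndepFun.variance_sum (fun j _ => memLp_clock hm hl j)
      fun i _ j _ hij => hi.indepFun hij]
    simp [variance_clock hm hl, mul_comm]
  have := meas_ge_le_variance_div_sq hL hη
  rwa [hE, hVar] at this

/-- The strong law excludes explosion: almost surely every `t ≥ 0` lies between two jump times. -/
lemma ae_tendsto_jumpTime (hm : ∀ n, Measurable (σ n)) (hl : ∀ n, P.map (σ n) = expMeasure 1)
    (hi : iIndepFun σ P) : ∀ᵐ ω ∂P, Tendsto (fun n => jumpTime σ n ω) atTop atTop := by
  have h := strong_law_ae_real σ ((memLp_clock hm hl 0).integrable (by norm_num))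
    (fun i j hij => hi.indepFun hij) fun i =>
      ⟨(hm i).aemeasurable, (hm 0).aemeasurable, by rw [hl i, hl 0]⟩
  rw [integral_clock hm hl 0] at h
  filter_upwards [h] with ω hω
  have h2 := hω.pos_mul_atTop one_pos tendsto_natCast_atTop_atTop
  refine h2.congr' ?_
  filter_upwards [eventually_gt_atTop 0] with n hn
  have : (n : ℝ) ≠ 0 := by exact_mod_cast hn.ne'
  rw [jumpTime, div_mul_cancel₀ _ this]

end JumpTime

/-! ### The Markov property and the second moment of the noise -/

section Maps

variable {τ : ℝ} {N : ℕ}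

lemma measurable_birthMap : Measurable (birthMap τ N) := by
  refine measurable_pi_iff.2 fun j => ?_
  refine Fin.cases ?_ (fun i => ?_) j
  · simp only [birthMap, Fin.cons_zero]
    fun_prop
  · simp only [birthMap, Fin.cons_succ, Fin.init]
    fun_prop

lemma measurable_deathMap : Measurable (deathMap τ N) := by
  refine measurable_pi_iff.2 fun j => ?_
  refine Fin.cases ?_ (fun i => ?_) j
  · simp only [deathMap, Fin.cons_zero]
    fun_prop
  · simp only [deathMap, Fin.cons_succ, Fin.init]
    fun_prop

lemma transitionLaw_real_apply (x : MemoryState τ N) {B : Set (MemoryState τ N)}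
    (hB : MeasurableSet B) :
    (transitionLaw τ N x).real B = 1 / 2 * B.indicator (fun _ => (1 : ℝ)) (deathMap τ N x) +
      1 / 2 * B.indicator (fun _ => (1 : ℝ)) (birthMap τ N x) := by
  rw [transitionLaw, measureReal_add_apply (ENNReal.mul_ne_top (by simp) (measure_ne_top _ _))
      (ENNReal.mul_ne_top (by simp) (measure_ne_top _ _)), measureReal_ennreal_smul_apply,
    measureReal_ennreal_smul_apply, measureReal_def, measureReal_def, Measure.dirac_apply' _ hB,
    Measure.dirac_apply' _ hB]
  by_cases h1 : deathMap τ N x ∈ B <;> by_cases h2 : birthMap τ N x ∈ B <;> simp [h1, h2]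

end Maps

/-- The deviation, accumulated over the first `n` steps, of the present population size along the
path `p` from its conditional expectation. -/
def chainNoise (τ : ℝ) (N : ℕ) (p : ℕ → MemoryState τ N) (n : ℕ) : ℝ :=
  ∑ k ∈ Finset.range n,
    ((p (k + 1) 0 : ℝ) - ((deathMap τ N (p k) 0 : ℝ) + (birthMap τ N (p k) 0 : ℝ)) / 2)

namespace IsLongMemoryChain

variable {τ μ : ℝ} {N : ℕ} {Ω : Type*} [MeasurableSpace Ω] {P : Measure Ω} [IsProbabilityMeasure P]
  {ξ : ℕ → Ω → MemoryState τ N} {σ : ℕ → Ω → ℝ}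

/-- The joint law of an observable of the past and of the next state. -/
lemma map_prodMk_succ (h : IsLongMemoryChain τ μ N P ξ σ) (n : ℕ) {S : Type*} [MeasurableSpace S]
    {H : Ω → S}
    (hH : Measurable[⨆ i ∈ Set.Iic n, MeasurableSpace.comap (ξ i) inferInstance] H) :
    P.map (fun ω => (H ω, ξ (n + 1) ω)) =
      (2⁻¹ : ℝ≥0∞) • P.map (fun ω => (H ω, deathMap τ N (ξ n ω))) +
        (2⁻¹ : ℝ≥0∞) • P.map (fun ω => (H ω, birthMap τ N (ξ n ω))) := by
  have hle : (⨆ i ∈ Set.Iic n, MeasurableSpace.comap (ξ i) inferInstance) ≤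
      (inferInstance : MeasurableSpace Ω) :=
    iSup₂_le fun i _ => (h.measurable_chain i).comap_le
  have hH' : Measurable H := hH.mono hle le_rfl
  have hd : Measurable fun ω => deathMap τ N (ξ n ω) :=
    measurable_deathMap.comp (h.measurable_chain n)
  have hb : Measurable fun ω => birthMap τ N (ξ n ω) :=
    measurable_birthMap.comp (h.measurable_chain n)
  have hξ := h.measurable_chain (n + 1)
  have := Measure.isProbabilityMeasure_map (μ := P) (hH'.prodMk hξ).aemeasurable
  refine Measure.ext_prod fun {s} {t} hs ht => ?_
  rw [Measure.add_apply, Measure.smul_apply, Measure.smul_apply,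
    Measure.map_apply (hH'.prodMk hξ) (hs.prod ht),
    Measure.map_apply (hH'.prodMk hd) (hs.prod ht), Measure.map_apply (hH'.prodMk hb) (hs.prod ht)]
  -- Rectangles suffice. `H ⁻¹' s` is a past event, so the Markov property may be integrated over
  -- it.
  have hA : MeasurableSet[⨆ i ∈ Set.Iic n, MeasurableSpace.comap (ξ i) inferInstance] (H ⁻¹' s) :=
    hH hs
  have hint : Integrable ((ξ (n + 1) ⁻¹' t).indicator fun _ => (1 : ℝ)) P :=
    (integrable_const 1).indicator (hξ ht)
  have h1 := setIntegral_condExp hle hint hA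
  rw [setIntegral_congr_ae (hle _ hA) ((h.markov n t ht).mono fun ω hω _ => hω)] at h1
  have hi1 : Integrable ((fun ω => deathMap τ N (ξ n ω)) ⁻¹' t |>.indicator fun _ => (1 : ℝ)) P :=
    (integrable_const 1).indicator (hd ht)
  have hi2 : Integrable ((fun ω => birthMap τ N (ξ n ω)) ⁻¹' t |>.indicator fun _ => (1 : ℝ)) P :=
    (integrable_const 1).indicator (hb ht)
  have h2 : ∀ ω, (transitionLaw τ N (ξ n ω)).real t =
      1 / 2 * ((fun ω => deathMap τ N (ξ n ω)) ⁻¹' t).indicator (fun _ => (1 : ℝ)) ω +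
      1 / 2 * ((fun ω => birthMap τ N (ξ n ω)) ⁻¹' t).indicator (fun _ => (1 : ℝ)) ω :=
    fun ω => transitionLaw_real_apply _ ht
  simp_rw [h2] at h1
  rw [integral_add (hi1.integrableOn.const_mul _) (hi2.integrableOn.const_mul _),
    integral_const_mul, integral_const_mul, setIntegral_indicator (hξ ht),
    setIntegral_indicator (hd ht), setIntegral_indicator (hb ht)] at h1
  simp only [setIntegral_const, smul_eq_mul, mul_one] at h1
  have e : ∀ g : Ω → MemoryState τ N, (fun ω => (H ω, g ω)) ⁻¹' s ×ˢ t = H ⁻¹' s ∩ g ⁻¹' t :=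
    fun g => rfl
  rw [e, e, e, ← ENNReal.toReal_eq_toReal_iff' (measure_ne_top _ _)
    (by simp [ENNReal.mul_eq_top, measure_ne_top]), smul_eq_mul, smul_eq_mul,
    ENNReal.toReal_add (by simp [ENNReal.mul_eq_top, measure_ne_top])
      (by simp [ENNReal.mul_eq_top, measure_ne_top]), ENNReal.toReal_mul, ENNReal.toReal_mul]
  simp only [measureReal_def] at h1
  rw [← h1]
  norm_num

/-- Both components of the joint law of `(ξ n, ξ (n + 1))` are carried by the graph of a map. From
here on, path estimates are deterministic. -/
lemma ae_succ_eq (h : IsLongMemoryChain τ μ N P ξ σ) :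
    ∀ᵐ ω ∂P, ∀ n, ξ (n + 1) ω = deathMap τ N (ξ n ω) ∨ ξ (n + 1) ω = birthMap τ N (ξ n ω) := by
  refine ae_all_iff.2 fun n => ?_
  have hH : Measurable[⨆ i ∈ Set.Iic n, MeasurableSpace.comap (ξ i) inferInstance] (ξ n) :=
    measurable_iff_comap_le.2 (le_iSup₂_of_le n (Set.mem_Iic.2 le_rfl) le_rfl)
  have hmap := h.map_prodMk_succ n hH
  have hξ := h.measurable_chain n
  have hd : Measurable fun ω => deathMap τ N (ξ n ω) := measurable_deathMap.comp hξ
  have hb : Measurable fun ω => birthMap τ N (ξ n ω) := measurable_birthMap.comp hξ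
  have hS : MeasurableSet {p : MemoryState τ N × MemoryState τ N |
      p.2 = deathMap τ N p.1 ∨ p.2 = birthMap τ N p.1} :=
    (measurableSet_eq_fun measurable_snd (measurable_deathMap.comp measurable_fst)).union
      (measurableSet_eq_fun measurable_snd (measurable_birthMap.comp measurable_fst))
  have hae : ∀ᵐ p ∂P.map (fun ω => (ξ n ω, ξ (n + 1) ω)),
      p.2 = deathMap τ N p.1 ∨ p.2 = birthMap τ N p.1 := by
    rw [hmap, ae_add_measure_iff]
    refine ⟨Measure.ae_smul_measure ?_ _, Measure.ae_smul_measure ?_ _⟩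
    · rw [ae_map_iff (hξ.prodMk hd).aemeasurable hS]
      exact Eventually.of_forall fun ω => Or.inl rfl
    · rw [ae_map_iff (hξ.prodMk hb).aemeasurable hS]
      exact Eventually.of_forall fun ω => Or.inr rfl
  rwa [ae_map_iff (hξ.prodMk (h.measurable_chain (n + 1))).aemeasurable hS] at hae

lemma measurable_chainNoise (n : ℕ) :
    Measurable fun p : ℕ → MemoryState τ N => chainNoise τ N p n := by
  unfold chainNoise
  refine Finset.measurable_sum _ fun k _ => ?_
  have h1 : ∀ j : ℕ, Measurable fun p : ℕ → MemoryState τ N => p j :=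
    fun j => measurable_pi_apply j
  have h2 := (measurable_pi_apply (0 : Fin (⌊τ * N⌋₊ + 1))).comp (h1 (k + 1))
  have h3 := (measurable_pi_apply (0 : Fin (⌊τ * N⌋₊ + 1))).comp (measurable_deathMap.comp (h1 k))
  have h4 := (measurable_pi_apply (0 : Fin (⌊τ * N⌋₊ + 1))).comp (measurable_birthMap.comp (h1 k))
  exact h2.coe_nnreal_real.sub ((h3.coe_nnreal_real.add h4.coe_nnreal_real).div_const 2)

/-- Given the past, the increment is plus or minus half the difference of the two maps with equal
weights, so the cross terms cancel. Using `∫⁻` of squares requires no integrability. -/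
lemma lintegral_sq_chainNoise_succ (h : IsLongMemoryChain τ μ N P ξ σ) (n : ℕ) :
    ∫⁻ ω, ENNReal.ofReal (chainNoise τ N (fun i => ξ i ω) (n + 1) ^ 2) ∂P =
      ∫⁻ ω, ENNReal.ofReal (chainNoise τ N (fun i => ξ i ω) n ^ 2) ∂P +
      ∫⁻ ω, ENNReal.ofReal
        ((((birthMap τ N (ξ n ω) 0 : ℝ) - (deathMap τ N (ξ n ω) 0 : ℝ)) / 2) ^ 2) ∂P := by
  -- The path frozen at time `n` is an observable of the past and has the same noise up to `n`.
  set H : Ω → ℕ → MemoryState τ N := fun ω i => ξ (min i n) ω with hHdef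
  have hH : Measurable[⨆ i ∈ Set.Iic n, MeasurableSpace.comap (ξ i) inferInstance] H := by
    refine @measurable_pi_lambda _ _ _ (_) _ _ fun i => measurable_iff_comap_le.2 ?_
    exact le_iSup₂_of_le (min i n) (Set.mem_Iic.2 (min_le_right _ _)) le_rfl
  have hmap := h.map_prodMk_succ n hH
  have hHm : Measurable H := measurable_pi_lambda _ fun i => h.measurable_chain _
  have hξ := h.measurable_chain n
  have hN : ∀ ω, chainNoise τ N (H ω) n = chainNoise τ N (fun i => ξ i ω) n := by
    intro ω
    refine Finset.sum_congr rfl fun k hk => ?_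
    have hk' := Finset.mem_range.1 hk
    simp only [hHdef, min_eq_left hk'.le, min_eq_left (Nat.succ_le_of_lt hk')]
  have hn : ∀ ω, H ω n = ξ n ω := fun ω => by simp [hHdef]
  set G : (ℕ → MemoryState τ N) × MemoryState τ N → ℝ≥0∞ := fun q =>
    ENNReal.ofReal ((chainNoise τ N q.1 n +
      ((q.2 0 : ℝ) - ((deathMap τ N (q.1 n) 0 : ℝ) + (birthMap τ N (q.1 n) 0 : ℝ)) / 2)) ^ 2)
    with hG
  have hGm : Measurable G := by
    have h1 : Measurable fun q : (ℕ → MemoryState τ N) × MemoryState τ N => q.1 n :=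
      (measurable_pi_apply n).comp measurable_fst
    have h0 : Measurable fun q : (ℕ → MemoryState τ N) × MemoryState τ N => q.2 := measurable_snd
    have h2 := (measurable_pi_apply (0 : Fin (⌊τ * N⌋₊ + 1))).comp h0
    have h3 := (measurable_pi_apply (0 : Fin (⌊τ * N⌋₊ + 1))).comp (measurable_deathMap.comp h1)
    have h4 := (measurable_pi_apply (0 : Fin (⌊τ * N⌋₊ + 1))).comp (measurable_birthMap.comp h1)
    exact ((((measurable_chainNoise n).comp measurable_fst).add (h2.coe_nnreal_real.sub
      ((h3.coe_nnreal_real.add h4.coe_nnreal_real).div_const 2))).pow_const 2).ennreal_ofReal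
  have hdm : Measurable fun ω => deathMap τ N (ξ n ω) := measurable_deathMap.comp hξ
  have hbm : Measurable fun ω => birthMap τ N (ξ n ω) := measurable_birthMap.comp hξ
  have hGd : Measurable fun ω => G (H ω, deathMap τ N (ξ n ω)) := hGm.comp (hHm.prodMk hdm)
  have hGb : Measurable fun ω => G (H ω, birthMap τ N (ξ n ω)) := hGm.comp (hHm.prodMk hbm)
  have hl := congrArg (fun ν => ∫⁻ q, G q ∂ν) hmap
  simp only [lintegral_add_measure, lintegral_smul_measure] at hl
  rw [lintegral_map hGm (hHm.prodMk (h.measurable_chain (n + 1))),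
    lintegral_map hGm (hHm.prodMk hdm), lintegral_map hGm (hHm.prodMk hbm), smul_eq_mul,
    smul_eq_mul, ← lintegral_const_mul _ hGd, ← lintegral_const_mul _ hGb,
    ← lintegral_add_left (hGd.const_mul _)] at hl
  have hXm : Measurable fun ω => chainNoise τ N (fun i => ξ i ω) n :=
    (measurable_chainNoise n).comp (measurable_pi_lambda _ h.measurable_chain)
  rw [← lintegral_add_left (hXm.pow_const 2).ennreal_ofReal]
  refine Eq.trans ?_ (hl.trans ?_)
  · refine lintegral_congr fun ω => ?_
    simp only [hG, hN, hn]
    simp only [chainNoise, Finset.sum_range_succ]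
  · refine lintegral_congr fun ω => ?_
    simp only [hG, hN, hn]
    have h2 : (2⁻¹ : ℝ≥0∞) = ENNReal.ofReal (1 / 2) := by
      rw [one_div, ENNReal.ofReal_inv_of_pos two_pos, ENNReal.ofReal_ofNat]
    rw [h2, ← ENNReal.ofReal_mul (by norm_num), ← ENNReal.ofReal_mul (by norm_num),
      ← ENNReal.ofReal_add (by positivity) (by positivity),
      ← ENNReal.ofReal_add (by positivity) (by positivity)]
    congr 1
    ring

lemma measure_le_abs_chainNoise_le (h : IsLongMemoryChain τ μ N P ξ σ) {M : ℕ} {D : ℝ}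
    (hD : ∀ᵐ ω ∂P, ∀ n < M,
      |((birthMap τ N (ξ n ω) 0 : ℝ) - (deathMap τ N (ξ n ω) 0 : ℝ)) / 2| ≤ D)
    {n : ℕ} (hn : n ≤ M) {η : ℝ} (hη : 0 < η) :
    P {ω | η ≤ |chainNoise τ N (fun i => ξ i ω) n|} ≤ ENNReal.ofReal (D ^ 2 * n / η ^ 2) := by
  have hmom : ∀ n ≤ M, ∫⁻ ω, ENNReal.ofReal (chainNoise τ N (fun i => ξ i ω) n ^ 2) ∂P ≤
      ENNReal.ofReal (D ^ 2 * n) := by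
    intro n
    induction n with
    | zero => simp [chainNoise]
    | succ n ih =>
      intro hn
      rw [h.lintegral_sq_chainNoise_succ n, Nat.cast_succ, mul_add, mul_one,
        ENNReal.ofReal_add (by positivity) (by positivity)]
      refine add_le_add (ih (by omega)) ?_
      calc _ ≤ ∫⁻ _, ENNReal.ofReal (D ^ 2) ∂P := by
            refine lintegral_mono_ae ?_
            filter_upwards [hD] with ω hω
            exact ENNReal.ofReal_le_ofReal (sq_le_sq' (abs_le.1 (hω n hn)).1 (abs_le.1 (hω n hn)).2)
        _ = _ := by simp
  have hXm : Measurable fun ω => chainNoise τ N (fun i => ξ i ω) n :=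
    (measurable_chainNoise n).comp (measurable_pi_lambda _ h.measurable_chain)
  have hmk := meas_ge_le_lintegral_div (μ := P) (hXm.pow_const 2).ennreal_ofReal.aemeasurable
    (ε := ENNReal.ofReal (η ^ 2)) (by positivity) ENNReal.ofReal_ne_top
  calc _ ≤ P {ω | ENNReal.ofReal (η ^ 2) ≤
        ENNReal.ofReal (chainNoise τ N (fun i => ξ i ω) n ^ 2)} := by
        refine measure_mono fun ω hω => ENNReal.ofReal_le_ofReal ?_
        rw [← sq_abs (chainNoise τ N (fun i => ξ i ω) n)]
        exact pow_le_pow_left₀ hη.le hω 2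
    _ ≤ _ := hmk
    _ ≤ ENNReal.ofReal (D ^ 2 * n) / ENNReal.ofReal (η ^ 2) := by
        gcongr
        exact hmom n hn
    _ = _ := (ENNReal.ofReal_div_of_pos (by positivity)).symm

end IsLongMemoryChain

/-! ### Deterministic estimates along a path -/

section Path

variable {τ μ : ℝ} {N : ℕ} {p : ℕ → MemoryState τ N}

/-- The coordinate of index `j` is the present population size of `j` steps ago. -/
lemma path_apply_eq
    (hp : ∀ n, p (n + 1) = deathMap τ N (p n) ∨ p (n + 1) = birthMap τ N (p n))
    (h0 : ∀ j, (p 0 j : ℝ) = μ * N) (n : ℕ) (j : Fin (⌊τ * N⌋₊ + 1)) :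
    p n j = p (n - j) 0 := by
  induction n generalizing j with
  | zero =>
    rw [Nat.zero_sub]
    exact NNReal.coe_injective ((h0 j).trans (h0 0).symm)
  | succ n ih =>
    refine Fin.cases rfl (fun i => ?_) j
    have h1 : p (n + 1) i.succ = p n i.castSucc := by
      rcases hp n with h | h <;> rw [h]
      · simp only [deathMap, Fin.cons_succ, Fin.init]
      · simp only [birthMap, Fin.cons_succ, Fin.init]
    rw [h1, ih]
    simp

lemma path_zero_le (hN : 1 ≤ N) (hμ : μ ≤ 1)
    (hp : ∀ n, p (n + 1) = deathMap τ N (p n) ∨ p (n + 1) = birthMap τ N (p n))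
    (h0 : ∀ j, (p 0 j : ℝ) = μ * N) (n : ℕ) :
    (p n 0 : ℝ) ≤ N * (1 + 1 / (N : ℝ)) ^ n := by
  have hN' : (0 : ℝ) < N := by exact_mod_cast hN
  induction n with
  | zero =>
    rw [h0, pow_zero, mul_one]
    exact (mul_le_mul_of_nonneg_right hμ hN'.le).trans (one_mul _).le
  | succ n ih =>
    have hx : (0 : ℝ) ≤ p n 0 := NNReal.coe_nonneg _
    have h1 : (p (n + 1) 0 : ℝ) ≤ p n 0 * (1 + 1 / (N : ℝ)) := by
      rcases hp n with h | h <;> rw [h]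
      · simp only [deathMap, Fin.cons_zero, Real.coe_toNNReal']
        refine max_le (mul_le_mul_of_nonneg_left ?_ hx) (by positivity)
        have e1 : (0 : ℝ) ≤ (p n (Fin.last _) : ℝ) / (N : ℝ) ^ 2 := by positivity
        have e2 : (0 : ℝ) ≤ 1 / (N : ℝ) := by positivity
        linarith
      · simp [birthMap]
    refine h1.trans ?_
    rw [pow_succ, ← mul_assoc]
    gcongr

lemma path_zero_div_le_exp (hN : 1 ≤ N) (hμ : μ ≤ 1)
    (hp : ∀ n, p (n + 1) = deathMap τ N (p n) ∨ p (n + 1) = birthMap τ N (p n))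
    (h0 : ∀ j, (p 0 j : ℝ) = μ * N) {n : ℕ} {R : ℝ} (hn : (n : ℝ) ≤ R * N) :
    (p n 0 : ℝ) / N ≤ Real.exp R := by
  have hN' : (0 : ℝ) < N := by exact_mod_cast hN
  rw [div_le_iff₀ hN', mul_comm (Real.exp R)]
  refine (path_zero_le hN hμ hp h0 n).trans (mul_le_mul_of_nonneg_left ?_ hN'.le)
  have h1 : 1 + 1 / (N : ℝ) ≤ Real.exp (1 / N) := by linarith [Real.add_one_le_exp (1 / (N : ℝ))]
  refine (pow_le_pow_left₀ (by positivity) h1 n).trans ?_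
  rw [← Real.exp_nat_mul]
  refine Real.exp_le_exp.2 ?_
  rwa [mul_one_div, div_le_iff₀ hN']

lemma birthMap_zero (x : MemoryState τ N) :
    (birthMap τ N x 0 : ℝ) = x 0 * (1 + 1 / (N : ℝ)) := by
  simp [birthMap]

/-- The truncation at `0` is inactive while populations are `O(N)` and `N` is large. -/
lemma deathMap_zero (hN : 1 ≤ N) {x : MemoryState τ N}
    (hx : (x (Fin.last _) : ℝ) / N ≤ N) :
    (deathMap τ N x 0 : ℝ) = x 0 * (1 - (x (Fin.last _) : ℝ) / (N : ℝ) ^ 2) := by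
  have hN' : (0 : ℝ) < N := by exact_mod_cast hN
  simp only [deathMap, Fin.cons_zero]
  refine Real.coe_toNNReal _ (mul_nonneg (NNReal.coe_nonneg _) (sub_nonneg.2 ?_))
  rw [div_le_iff₀ hN'] at hx
  rw [div_le_one (by positivity), sq]
  exact hx

lemma abs_birthMap_sub_deathMap_le (hN : 1 ≤ N) {C : ℝ} (hCN : C ≤ N) {x : MemoryState τ N}
    (hx0 : (x 0 : ℝ) / N ≤ C) (hx : (x (Fin.last _) : ℝ) / N ≤ C) :
    |((birthMap τ N x 0 : ℝ) - (deathMap τ N x 0 : ℝ)) / 2| ≤ C * (1 + C) := by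
  have hN' : (0 : ℝ) < N := by exact_mod_cast hN
  have hx0' : (0 : ℝ) ≤ (x 0 : ℝ) / N := by positivity
  have hx' : (0 : ℝ) ≤ (x (Fin.last _) : ℝ) / N := by positivity
  have e : ((birthMap τ N x 0 : ℝ) - (deathMap τ N x 0 : ℝ)) / 2 =
      (x 0 : ℝ) / N * (1 + (x (Fin.last _) : ℝ) / N) / 2 := by
    rw [birthMap_zero, deathMap_zero hN (hx.trans hCN)]
    field_simp
    ring
  rw [e, abs_of_nonneg (by positivity)]
  refine (half_le_self (by positivity)).trans ?_
  have : 0 ≤ C := hx0'.trans hx0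
  gcongr

lemma chainNoise_step_ge {D : ℝ}
    (hp : ∀ n, p (n + 1) = deathMap τ N (p n) ∨ p (n + 1) = birthMap τ N (p n)) {n : ℕ}
    (hD : |((birthMap τ N (p n) 0 : ℝ) - (deathMap τ N (p n) 0 : ℝ)) / 2| ≤ D) :
    chainNoise τ N p n - D ≤ chainNoise τ N p (n + 1) := by
  have hD' := abs_le.1 hD
  have e : chainNoise τ N p (n + 1) = chainNoise τ N p n +
    ((p (n + 1) 0 : ℝ) - ((deathMap τ N (p n) 0 : ℝ) + (birthMap τ N (p n) 0 : ℝ)) / 2) := by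
    simp only [chainNoise, Finset.sum_range_succ]
  rw [e]
  rcases hp n with h | h <;> rw [h] <;> linarith [hD'.1, hD'.2]

/-- The mean of the two maps is `x_0 + x_0 (1 - x_{-m} / N) / (2 N)`, and the last coordinate is the
present one `m` steps earlier. -/
lemma path_zero_div_succ (hN : 1 ≤ N)
    (hp : ∀ n, p (n + 1) = deathMap τ N (p n) ∨ p (n + 1) = birthMap τ N (p n))
    (h0 : ∀ j, (p 0 j : ℝ) = μ * N) {n : ℕ}
    (hn : (p (n - ⌊τ * N⌋₊) 0 : ℝ) / N ≤ N) :
    (p (n + 1) 0 : ℝ) / N = (p n 0 : ℝ) / N +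
      1 / (N : ℝ) * (1 / 2 * ((p n 0 : ℝ) / N) * (1 - (p (n - ⌊τ * N⌋₊) 0 : ℝ) / N)) +
      (chainNoise τ N p (n + 1) / N - chainNoise τ N p n / N) := by
  have hN' : (0 : ℝ) < N := by exact_mod_cast hN
  have hlast : p n (Fin.last _) = p (n - ⌊τ * N⌋₊) 0 := by
    rw [path_apply_eq hp h0, Fin.val_last]
  have e : chainNoise τ N p (n + 1) = chainNoise τ N p n +
    ((p (n + 1) 0 : ℝ) - ((deathMap τ N (p n) 0 : ℝ) + (birthMap τ N (p n) 0 : ℝ)) / 2) := by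
    simp only [chainNoise, Finset.sum_range_succ]
  rw [e, birthMap_zero, deathMap_zero hN (by rw [hlast]; exact hn), hlast]
  field_simp
  ring

end Path

/-! ### From steps to continuous time -/

section TimeChange

variable {τ : ℝ} {N : ℕ} {Ω : Type*} {ξ : ℕ → Ω → MemoryState τ N} {σ : ℕ → Ω → ℝ} {ω : Ω}

lemma strictMono_jumpTime (hpos : ∀ n, 0 < σ n ω) : StrictMono fun n => jumpTime σ n ω :=
  strictMono_nat_of_lt_succ fun n => by
    simp only [jumpTime, Finset.sum_range_succ]
    linarith [hpos n]

lemma continuousTimeChain_eq (hpos : ∀ n, 0 < σ n ω) {n : ℕ} {t : ℝ}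
    (ht : t ∈ Set.Ico (jumpTime σ n ω) (jumpTime σ (n + 1) ω)) :
    continuousTimeChain ξ σ t ω = ξ n ω := by
  have hmono := (strictMono_jumpTime hpos).monotone
  rw [continuousTimeChain, tsum_eq_single n, Set.indicator_of_mem ht]
  intro k hk
  refine Set.indicator_of_notMem (fun hk' => ?_) _
  rcases hk.lt_or_gt with h | h
  · exact (hk'.2.trans_le ((hmono (Nat.succ_le_of_lt h)).trans ht.1)).false
  · exact (ht.2.trans_le ((hmono (Nat.succ_le_of_lt h)).trans hk'.1)).false

lemma exists_jumpTime_le_lt (htop : Tendsto (fun n => jumpTime σ n ω) atTop atTop) {t : ℝ}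
    (ht : 0 ≤ t) : ∃ n, t ∈ Set.Ico (jumpTime σ n ω) (jumpTime σ (n + 1) ω) := by
  obtain ⟨k, hk⟩ := (htop.eventually_gt_atTop t).exists
  classical
  have hex : ∃ k, t < jumpTime σ k ω := ⟨k, hk⟩
  have h0 : Nat.find hex ≠ 0 := fun h => by
    have := Nat.find_spec hex
    rw [h] at this
    simp only [jumpTime, Finset.range_zero, Finset.sum_empty] at this
    linarith
  obtain ⟨n, hn⟩ := Nat.exists_eq_succ_of_ne_zero h0
  refine ⟨n, not_lt.1 (Nat.find_min hex (by omega)), ?_⟩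
  have := Nat.find_spec hex
  rwa [hn] at this

/-- The left-open variant serves left limits: at a jump time it selects the state before the jump.
-/
lemma exists_jumpTime_lt_le (htop : Tendsto (fun n => jumpTime σ n ω) atTop atTop) {t : ℝ}
    (ht : 0 < t) : ∃ n, t ∈ Set.Ioc (jumpTime σ n ω) (jumpTime σ (n + 1) ω) := by
  obtain ⟨k, hk⟩ := (htop.eventually_ge_atTop t).exists
  classical
  have hex : ∃ k, t ≤ jumpTime σ k ω := ⟨k, hk⟩
  have h0 : Nat.find hex ≠ 0 := fun h => by
    have := Nat.find_spec hex
    rw [h] at this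
    simp only [jumpTime, Finset.range_zero, Finset.sum_empty] at this
    linarith
  obtain ⟨n, hn⟩ := Nat.exists_eq_succ_of_ne_zero h0
  refine ⟨n, not_le.1 (Nat.find_min hex (by omega)), ?_⟩
  have := Nat.find_spec hex
  rwa [hn] at this

lemma eventually_continuousTimeChain_eq (hpos : ∀ n, 0 < σ n ω)
    (htop : Tendsto (fun n => jumpTime σ n ω) atTop atTop) {t : ℝ} (ht : 0 ≤ t) :
    ∀ᶠ s in 𝓝[≥] t, continuousTimeChain ξ σ s ω = continuousTimeChain ξ σ t ω := by
  obtain ⟨n, hn⟩ := exists_jumpTime_le_lt htop ht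
  filter_upwards [Ico_mem_nhdsGE hn.2] with s hs
  rw [continuousTimeChain_eq hpos hn, continuousTimeChain_eq hpos ⟨hn.1.trans hs.1, hs.2⟩]

lemma exists_eventually_continuousTimeChain_eq (hpos : ∀ n, 0 < σ n ω)
    (htop : Tendsto (fun n => jumpTime σ n ω) atTop atTop) {t : ℝ} (ht : 0 < t) :
    ∃ x, ∀ᶠ s in 𝓝[<] t, continuousTimeChain ξ σ s ω = x := by
  obtain ⟨n, hn⟩ := exists_jumpTime_lt_le htop ht
  refine ⟨ξ n ω, ?_⟩
  filter_upwards [Ioo_mem_nhdsLT hn.1] with s hs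
  exact continuousTimeChain_eq hpos ⟨hs.1.le, hs.2.trans_le hn.2⟩

lemma isCadlag_of_eventually_eq {a b : ℝ} {y : ℝ → ℝ}
    (hr : ∀ t, a ≤ t → ∀ᶠ s in 𝓝[≥] t, y s = y t)
    (hl : ∀ t, a < t → ∃ c, ∀ᶠ s in 𝓝[<] t, y s = c) :
    IsCadlag fun t : Set.Icc a b => y t := by
  intro t
  constructor
  · have h : ContinuousWithinAt y (Set.Ici (t : ℝ)) t :=
      tendsto_const_nhds.congr' ((hr t t.2.1).mono fun s hs => hs.symm)
    exact h.comp continuous_subtype_val.continuousWithinAt fun s hs => hs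
  · rcases t.2.1.eq_or_lt with ht | ht
    · refine ⟨0, ?_⟩
      have : Set.Iio t = ∅ := by
        ext s
        simp only [Set.mem_Iio, Set.mem_empty_iff_false, iff_false, not_lt]
        exact Subtype.coe_le_coe.1 (ht ▸ s.2.1)
      rw [this, nhdsWithin_empty]
      exact tendsto_bot
    · obtain ⟨c, hc⟩ := hl t ht
      refine ⟨c, ?_⟩
      have hv : Tendsto (fun s : Set.Icc a b => (s : ℝ)) (𝓝[<] t) (𝓝[<] (t : ℝ)) :=
        continuous_subtype_val.continuousWithinAt.tendsto_nhdsWithin fun s hs => hs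
      exact tendsto_const_nhds.congr' ((hv.eventually hc).mono fun s hs => hs.symm)

lemma isCadlag_scaledProcess (hN : 1 ≤ N) (hpos : ∀ n, 0 < σ n ω)
    (htop : Tendsto (fun n => jumpTime σ n ω) atTop atTop) (T : ℝ) :
    IsCadlag fun t : Set.Icc (-τ) T => scaledProcess ξ σ t ω := by
  have hN' : (0 : ℝ) < N := by exact_mod_cast hN
  have hr (c t : ℝ) : Tendsto (fun s : ℝ => (N : ℝ) * (s + c)) (𝓝[≥] t) (𝓝[≥] (N * (t + c))) := by
    refine ContinuousWithinAt.tendsto_nhdsWithin (by fun_prop) fun s hs => ?_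
    exact mul_le_mul_of_nonneg_left (add_le_add_left (Set.mem_Ici.1 hs) c) hN'.le
  have hl (c t : ℝ) : Tendsto (fun s : ℝ => (N : ℝ) * (s + c)) (𝓝[<] t) (𝓝[<] (N * (t + c))) := by
    refine ContinuousWithinAt.tendsto_nhdsWithin (by fun_prop) fun s hs => ?_
    exact mul_lt_mul_of_pos_left (add_lt_add_left (Set.mem_Iio.1 hs) c) hN'
  refine isCadlag_of_eventually_eq (y := fun t => scaledProcess ξ σ t ω) (fun t ht => ?_)
    fun t ht => ?_
  · rcases lt_or_ge t 0 with h0 | h0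
    · filter_upwards [(hr τ t).eventually (eventually_continuousTimeChain_eq (ξ := ξ) hpos htop
        (mul_nonneg hN'.le (by linarith))), nhdsWithin_le_nhds (gt_mem_nhds h0)] with s hs hs0
      simp only [scaledProcess, if_pos h0, if_pos hs0, hs]
    · have h := hr 0 t
      simp only [add_zero] at h
      filter_upwards [h.eventually (eventually_continuousTimeChain_eq (ξ := ξ) hpos htop
        (mul_nonneg hN'.le h0)), self_mem_nhdsWithin] with s hs hs0
      simp only [scaledProcess, if_neg h0.not_gt, if_neg (h0.trans hs0).not_gt, hs]
  -- The left limit at `0` belongs to the history formula, hence a split at `t ≤ 0` instead of `t <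
  -- 0`.
  · rcases le_or_gt t 0 with h0 | h0
    · obtain ⟨x, hx⟩ := exists_eventually_continuousTimeChain_eq (ξ := ξ) hpos htop
        (mul_pos hN' (by linarith : 0 < t + τ))
      refine ⟨(x (Fin.last _) : ℝ) / N, ?_⟩
      filter_upwards [(hl τ t).eventually hx, self_mem_nhdsWithin] with s hs hs0
      simp only [scaledProcess, if_pos (lt_of_lt_of_le hs0 h0), hs]
    · obtain ⟨x, hx⟩ := exists_eventually_continuousTimeChain_eq (ξ := ξ) hpos htop
        (mul_pos hN' h0)
      have h := hl 0 t
      simp only [add_zero] at h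
      refine ⟨(x 0 : ℝ) / N, ?_⟩
      filter_upwards [h.eventually hx, nhdsWithin_le_nhds (lt_mem_nhds h0)] with s hs hs0
      simp only [scaledProcess, if_neg hs0.le.not_gt, hs]

/-- If the jump times are within `δ N` of the integers, then the number of jumps up to time `N t` is
close to `N t`. -/
lemma abs_jump_count_div_sub_le (hN : 1 ≤ N) (hpos : ∀ n, 0 < σ n ω) {R δ : ℝ} (hδ1 : δ ≤ 1)
    (hJ : ∀ n ≤ ⌊R * N⌋₊, |jumpTime σ n ω - n| ≤ δ * N) {n : ℕ} {t : ℝ}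
    (htR : t + 2 ≤ R)
    (ht : N * t ∈ Set.Ico (jumpTime σ n ω) (jumpTime σ (n + 1) ω)) :
    n < ⌊R * N⌋₊ ∧ |n * (1 / (N : ℝ)) - t| ≤ δ + 1 / (N : ℝ) := by
  have hN1 : (1 : ℝ) ≤ N := by exact_mod_cast hN
  have hN' : (0 : ℝ) < N := by linarith
  have hmono := strictMono_jumpTime hpos
  have hδN : δ * N ≤ N := by nlinarith
  -- Otherwise `J_n ≥ ⌊R N⌋ - δ N > (R - 1) N - 1 ≥ N t`. The margin `2` in `htR` pays for `δ ≤ 1`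
  -- and for the floor. Strictness allows `hJ` at `n + 1`.
  have hlt : n < ⌊R * N⌋₊ := by
    by_contra hcon
    have h1 := hmono.monotone (not_lt.1 hcon)
    have h2 := abs_le.1 (hJ _ le_rfl)
    have h3 := Nat.lt_floor_add_one (R * N)
    have h4 := mul_le_mul_of_nonneg_right htR hN'.le
    have h5 := ht.1
    nlinarith [h2.1]
  refine ⟨hlt, ?_⟩
  have h1 := abs_le.1 (hJ n hlt.le)
  have h2 := abs_le.1 (hJ (n + 1) hlt)
  push_cast at h2
  have e : (n : ℝ) * (1 / (N : ℝ)) - t = (n - N * t) / N := by field_simp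
  have e' : δ + 1 / (N : ℝ) = (δ * N + 1) / N := by field_simp
  rw [e, e', abs_div, abs_of_pos hN']
  gcongr
  exact abs_le.2 ⟨by linarith [ht.2, h2.2], by linarith [ht.1, h1.1]⟩

end TimeChange

/-! ### Uniform distance to the solution on the good event -/

section SupBound

variable {τ μ : ℝ} {N : ℕ} {Ω : Type*} {ξ : ℕ → Ω → MemoryState τ N} {σ : ℕ → Ω → ℝ} {ω : Ω}

lemma abs_path_zero_div_sub_delayedLogistic_le (hτ : 0 < τ) (hμ : μ ∈ Set.Ioo (0 : ℝ) 1)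
    (hN : 1 ≤ N) {R C ε : ℝ} (hR : 0 ≤ R) (hC : ∀ t ≤ R, delayedLogistic τ μ t ≤ C)
    (hexp : Real.exp R ≤ C) (hCN : C ≤ N) (hε : 0 ≤ ε) {p : ℕ → MemoryState τ N}
    (hp : ∀ n, p (n + 1) = deathMap τ N (p n) ∨ p (n + 1) = birthMap τ N (p n))
    (h0 : ∀ j, (p 0 j : ℝ) = μ * N)
    (hX : ∀ n ≤ ⌊R * N⌋₊, |chainNoise τ N p n| ≤ ε * N) :
    ∀ n ≤ ⌊R * N⌋₊, |(p n 0 : ℝ) / N - delayedLogistic τ μ (n * (1 / (N : ℝ)))| ≤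
      (ε + 1 / (N : ℝ) * (1 / 4 * C * (1 + C) * (1 + 3 * C))) * Real.exp ((3 / 2 + C) * R) := by
  have hN' : (0 : ℝ) < N := by exact_mod_cast hN
  have hA : ∀ n ≤ ⌊R * N⌋₊, (p n 0 : ℝ) / N ≤ C := fun n hn =>
    (path_zero_div_le_exp hN hμ.2.le hp h0
      ((Nat.cast_le.2 hn).trans (Nat.floor_le (by positivity)))).trans hexp
  refine abs_sub_delayedLogistic_le (m := ⌊τ * N⌋₊) (X := fun n => chainNoise τ N p n / N) hτ hμ.1
    hR hC hε (by positivity) ?_ ?_ ?_ ?_ ?_ (fun n hn => ⟨by positivity, hA n hn⟩)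
    (fun n hn => ?_) fun n hn => ?_
  · rw [mul_one_div, div_le_iff₀ hN']
    exact Nat.floor_le (by positivity)
  · rw [mul_one_div, ← add_div, le_div_iff₀ hN']
    exact (Nat.lt_floor_add_one _).le
  · rw [mul_one_div, div_le_iff₀ hN']
    exact Nat.floor_le (by positivity)
  · rw [h0, mul_div_cancel_right₀ _ hN'.ne']
  · simp [chainNoise]
  · rw [abs_div, abs_of_pos hN', div_le_iff₀ hN']
    exact hX n hn
  · exact path_zero_div_succ hN hp h0 ((hA _ ((Nat.sub_le _ _).trans hn.le)).trans hCN)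

lemma abs_scaledProcess_sub_delayedLogistic_le (hτ : 0 < τ) (hμ : μ ∈ Set.Ioo (0 : ℝ) 1)
    (hN : 1 ≤ N) {R C ε δ T : ℝ} (hT : 0 < T) (hR : T + τ + 2 ≤ R)
    (hC : ∀ t ≤ R, delayedLogistic τ μ t ≤ C) (hexp : Real.exp R ≤ C) (hCN : C ≤ N) (hε : 0 ≤ ε)
    (hδ1 : δ ≤ 1)
    (hξ : ∀ n, ξ (n + 1) ω = deathMap τ N (ξ n ω) ∨ ξ (n + 1) ω = birthMap τ N (ξ n ω))
    (h0 : ∀ j, (ξ 0 ω j : ℝ) = μ * N) (hpos : ∀ n, 0 < σ n ω)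
    (htop : Tendsto (fun n => jumpTime σ n ω) atTop atTop)
    (hJ : ∀ n ≤ ⌊R * N⌋₊, |jumpTime σ n ω - n| ≤ δ * N)
    (hX : ∀ n ≤ ⌊R * N⌋₊, |chainNoise τ N (fun i => ξ i ω) n| ≤ ε * N)
    {t : ℝ} (ht : t ∈ Set.Icc (-τ) T) :
    |(scaledProcess ξ σ t ω) - delayedLogistic τ μ t| ≤
      (ε + 1 / (N : ℝ) * (1 / 4 * C * (1 + C) * (1 + 3 * C))) * Real.exp ((3 / 2 + C) * R) +
        1 / 2 * C * (1 + C) * (δ + 2 * (1 / (N : ℝ))) := by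
  have hN' : (0 : ℝ) < N := by exact_mod_cast hN
  have hinv : 0 ≤ 1 / (N : ℝ) := by positivity
  have hR0 : 0 ≤ R := by linarith
  have hC0 : 0 ≤ C := (Real.exp_pos R).le.trans hexp
  have hpath := abs_path_zero_div_sub_delayedLogistic_le hτ hμ hN hR0 hC hexp hCN hε
    (p := fun i => ξ i ω) hξ h0 hX
  have hMR : ∀ n ≤ ⌊R * N⌋₊, (n : ℝ) * (1 / (N : ℝ)) ≤ R := fun n hn => by
    rw [mul_one_div, div_le_iff₀ hN']
    exact (Nat.cast_le.2 hn).trans (Nat.floor_le (by positivity))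
  -- `s` need not be `n / N`: in the history branch it may be negative while the truncated index is
  -- `0`, both giving the value `μ`.
  have htri : ∀ (n : ℕ) (s : ℝ), n ≤ ⌊R * N⌋₊ → s ≤ R →
      delayedLogistic τ μ (n * (1 / (N : ℝ))) = delayedLogistic τ μ s →
      |s - t| ≤ δ + 2 * (1 / (N : ℝ)) →
      |(ξ n ω 0 : ℝ) / N - delayedLogistic τ μ t| ≤
      (ε + 1 / (N : ℝ) * (1 / 4 * C * (1 + C) * (1 + 3 * C))) * Real.exp ((3 / 2 + C) * R) +
        1 / 2 * C * (1 + C) * (δ + 2 * (1 / (N : ℝ))) := by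
    intro n s hn hs hns hst
    have h1 := hpath n hn
    rw [hns] at h1
    have h2 := abs_delayedLogistic_sub_le hτ hμ.1 hR0 hC hs (by linarith [ht.2] : t ≤ R)
    refine (abs_sub_le _ (delayedLogistic τ μ s) _).trans (add_le_add h1 (h2.trans ?_))
    gcongr
  rcases lt_or_ge t 0 with ht0 | ht0
  · obtain ⟨n, hn⟩ := exists_jumpTime_le_lt htop
      (mul_nonneg hN'.le (by linarith [ht.1] : 0 ≤ t + τ))
    obtain ⟨hnM, hnt⟩ := abs_jump_count_div_sub_le hN hpos hδ1 hJ
      (by linarith : t + τ + 2 ≤ R) hn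
    rw [scaledProcess, if_pos ht0, continuousTimeChain_eq hpos hn,
      path_apply_eq (p := fun i => ξ i ω) hξ h0, Fin.val_last]
    have hm1 : (⌊τ * N⌋₊ : ℝ) * (1 / (N : ℝ)) ≤ τ := by
      rw [mul_one_div, div_le_iff₀ hN']
      exact Nat.floor_le (by positivity)
    have hm2 : τ ≤ (⌊τ * N⌋₊ : ℝ) * (1 / (N : ℝ)) + 1 / (N : ℝ) := by
      rw [mul_one_div, ← add_div, le_div_iff₀ hN']
      exact (Nat.lt_floor_add_one _).le
    have hm0 : 0 ≤ (⌊τ * N⌋₊ : ℝ) * (1 / (N : ℝ)) := by positivity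
    refine htri (n - ⌊τ * N⌋₊) (n * (1 / (N : ℝ)) - ⌊τ * N⌋₊ * (1 / (N : ℝ)))
      ((Nat.sub_le _ _).trans hnM.le) (by linarith [hMR n hnM.le]) ?_ ?_
    · rcases le_total ⌊τ * N⌋₊ n with hmn | hmn
      · rw [Nat.cast_sub hmn, sub_mul]
      · rw [Nat.sub_eq_zero_of_le hmn, delayedLogistic_of_nonpos hτ (by simp),
          delayedLogistic_of_nonpos hτ]
        exact sub_nonpos.2 (mul_le_mul_of_nonneg_right (by exact_mod_cast hmn) hinv)
    -- One `1 / N` comes from counting jumps, the other from `τ - m / N`.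
    · have := abs_le.1 hnt
      exact abs_le.2 ⟨by linarith [this.1], by linarith [this.2]⟩
  · obtain ⟨n, hn⟩ := exists_jumpTime_le_lt htop (mul_nonneg hN'.le ht0)
    obtain ⟨hnM, hnt⟩ := abs_jump_count_div_sub_le hN hpos hδ1 hJ
      (by linarith [ht.2] : t + 2 ≤ R) hn
    rw [scaledProcess, if_neg ht0.not_gt, continuousTimeChain_eq hpos hn]
    exact htri n (n * (1 / (N : ℝ))) hnM.le (hMR n hnM.le) rfl (by linarith)

end SupBound

/-- The identity time change costs nothing in time. -/
lemma SkorokhodSpace.edist_le_of_abs_sub_le {a b r : ℝ} {x y : SkorokhodSpace a b}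
    (h : ∀ t, |x.1 t - y.1 t| ≤ r) : edist x y ≤ ENNReal.ofReal r := by
  refine (iInf_le _ (OrderIso.refl _)).trans (max_le (iSup_le fun t => ?_) (iSup_le fun t => ?_))
  · simp
  · rw [OrderIso.refl_apply, edist_dist, Real.dist_eq]
    exact ENNReal.ofReal_le_ofReal (h t)

/-! ### Probability of the bad events and conclusion -/

section Convergence

variable {τ μ : ℝ} {Ω : ℕ → Type*} [∀ N, MeasurableSpace (Ω N)] {P : ∀ N, Measure (Ω N)}
  [∀ N, IsProbabilityMeasure (P N)] {ξ : ∀ N, ℕ → Ω N → MemoryState τ N} {σ : ∀ N, ℕ → Ω N → ℝ}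

/-- Exponential waiting times are unbounded above, but positivity means that `J_n - n` loses at most
`1` per step; this is why the grid bound is one-sided. -/
lemma tendsto_measure_jumpTime_deviation
    (hchain : ∀ N, 1 ≤ N → IsLongMemoryChain τ μ N (P N) (ξ N) (σ N)) {R δ : ℝ} (hR : 0 ≤ R)
    (hδ : 0 < δ) :
    Tendsto (fun N : ℕ => P N {ω | ∃ n ≤ ⌊R * N⌋₊, δ * N < |jumpTime (σ N) n ω - n|})
      atTop (𝓝 0) := by
  refine tendsto_measure_exists_lt_abs (X := fun N n ω => jumpTime (σ N) n ω - n)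
    (V := Var[fun x => x; expMeasure 1]) zero_le_one (variance_nonneg _ _)
    (fun N => Nat.floor_le (by positivity)) ?_ ?_ hδ
  · filter_upwards [eventually_ge_atTop 1] with N hN
    have h := hchain N hN
    filter_upwards [ae_clock_pos h.measurable_clock h.law_clock] with ω hω n _
    have := hω n
    simp only [jumpTime, Finset.sum_range_succ]
    push_cast
    linarith
  · filter_upwards [eventually_ge_atTop 1] with N hN n _ η hη
    have h := hchain N hN
    exact measure_le_abs_jumpTime_sub_le h.measurable_clock h.law_clock h.iIndep_clock n hη

lemma tendsto_measure_chainNoise_deviation (hμ : μ ≤ 1)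
    (hchain : ∀ N, 1 ≤ N → IsLongMemoryChain τ μ N (P N) (ξ N) (σ N)) {R ε : ℝ} (hR : 0 ≤ R)
    (hε : 0 < ε) :
    Tendsto (fun N : ℕ =>
      P N {ω | ∃ n ≤ ⌊R * N⌋₊, ε * N < |chainNoise τ N (fun i => ξ N i ω) n|}) atTop (𝓝 0) := by
  obtain ⟨N₀, hN₀⟩ := exists_nat_ge (Real.exp R)
  set D := Real.exp R * (1 + Real.exp R) with hD
  have hD0 : 0 ≤ D := by positivity
  have hbound : ∀ N, 1 ≤ N → N₀ ≤ N → ∀ᵐ ω ∂P N, ∀ n < ⌊R * N⌋₊,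
      |((birthMap τ N (ξ N n ω) 0 : ℝ) - (deathMap τ N (ξ N n ω) 0 : ℝ)) / 2| ≤ D := by
    intro N hN hNN
    have h := hchain N hN
    filter_upwards [h.ae_succ_eq, h.initial] with ω hξ h0 n hn
    have hle : ∀ k ≤ n, (ξ N k ω 0 : ℝ) / N ≤ Real.exp R := fun k hk =>
      path_zero_div_le_exp (p := fun i => ξ N i ω) hN hμ hξ h0
        ((Nat.cast_le.2 (hk.trans hn.le)).trans (Nat.floor_le (by positivity)))
    refine abs_birthMap_sub_deathMap_le hN (hN₀.trans (by exact_mod_cast hNN)) (hle n le_rfl) ?_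
    rw [path_apply_eq (p := fun i => ξ N i ω) hξ h0]
    exact hle _ (Nat.sub_le _ _)
  refine tendsto_measure_exists_lt_abs (X := fun N n ω => chainNoise τ N (fun i => ξ N i ω) n)
    hD0 (sq_nonneg D) (fun N => Nat.floor_le (by positivity)) ?_ ?_ hε
  · filter_upwards [eventually_ge_atTop 1, eventually_ge_atTop N₀] with N hN hNN
    filter_upwards [(hchain N hN).ae_succ_eq, hbound N hN hNN] with ω hξ hω n hn
    exact chainNoise_step_ge (p := fun i => ξ N i ω) hξ (hω n hn)
  · filter_upwards [eventually_ge_atTop 1, eventually_ge_atTop N₀] with N hN hNN n hn η hη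
    exact (hchain N hN).measure_le_abs_chainNoise_le (hbound N hN hNN) hn hη

end Convergence

end

theorem theorem2p1 (τ μ : ℝ) (hτ : 0 < τ) (hμ : μ ∈ Set.Ioo (0 : ℝ) 1)
    {Ω : ℕ → Type*} [∀ N, MeasurableSpace (Ω N)]
    (P : ∀ N, Measure (Ω N)) [∀ N, IsProbabilityMeasure (P N)]
    (ξ : ∀ N, ℕ → Ω N → MemoryState τ N) (σ : ∀ N, ℕ → Ω N → ℝ)
    (hchain : ∀ N, 1 ≤ N → IsLongMemoryChain τ μ N (P N) (ξ N) (σ N))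
    (T : ℝ) (hT : 0 < T) :
    ∃ (u : ℝ → ℝ) (hu : IsDelayedLogisticSolution τ μ T u),
      (∀ v : ℝ → ℝ, IsDelayedLogisticSolution τ μ T v → Set.EqOn v u (Set.Icc (-τ) T)) ∧
      ConvergesInProbabilitySkorokhod P
        (fun N ω (t : Set.Icc (-τ) T) => scaledProcess (ξ N) (σ N) t ω)
        (SkorokhodSpace.ofContinuousOn u hu.continuousOn) := by
  refine ⟨delayedLogistic τ μ, isDelayedLogisticSolution_delayedLogistic hτ T,
    fun v hv => hv.eqOn_delayedLogistic hτ hμ.1, fun N hN => ?_, fun U hU => ?_⟩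
  · have h := hchain N hN
    filter_upwards [ae_clock_pos h.measurable_clock h.law_clock,
      ae_tendsto_jumpTime h.measurable_clock h.law_clock h.iIndep_clock] with ω hpos htop
    exact isCadlag_scaledProcess hN hpos htop T
  obtain ⟨r, hr, hrU⟩ := EMetric.mem_nhds_iff.1 hU
  obtain ⟨ρ, hρ, hρr⟩ : ∃ ρ : ℝ, 0 < ρ ∧ ENNReal.ofReal ρ < r := by
    obtain ⟨q, hq0, hqr⟩ := ENNReal.lt_iff_exists_nnreal_btwn.1 hr
    exact ⟨q, by exact_mod_cast hq0, by rwa [ENNReal.ofReal_coe_nnreal]⟩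
  set R := T + τ + 2 with hRdef
  have hR0 : 0 ≤ R := by linarith
  obtain ⟨C₀, -, hC₀⟩ := delayedLogistic_le (R := R) hτ hμ.1
  set C := max C₀ (Real.exp R) with hCdef
  have hC : ∀ t ≤ R, delayedLogistic τ μ t ≤ C := fun t ht => (hC₀ t ht).trans (le_max_left _ _)
  have hexp : Real.exp R ≤ C := le_max_right _ _
  have hC0 : 0 < C := (Real.exp_pos R).trans_le hexp
  set G := Real.exp ((3 / 2 + C) * R) with hG
  have hG0 : 0 < G := Real.exp_pos _
  set L := 1 / 2 * C * (1 + C) with hL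
  have hL0 : 0 < L := by positivity
  set K := 1 / 4 * C * (1 + C) * (1 + 3 * C) with hK
  -- Error budget: `ρ / 4` for the noise, `ρ / 4` for the jump times, `ρ / 2` for the terms of order
  -- `1 / N`.
  set ε := ρ / (4 * G) with hεdef
  set δ := min 1 (ρ / (4 * L)) with hδdef
  have hε : 0 < ε := by positivity
  have hδ : 0 < δ := lt_min one_pos (by positivity)
  have hεG : ε * G = ρ / 4 := by rw [hεdef]; field_simp
  have hLδ : L * δ ≤ ρ / 4 := by
    calc L * δ ≤ L * (ρ / (4 * L)) := mul_le_mul_of_nonneg_left (min_le_right _ _) hL0.le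
      _ = ρ / 4 := by field_simp
  have hsmall : ∀ᶠ N : ℕ in atTop, (1 / (N : ℝ)) * (K * G + 2 * L) < ρ / 2 := by
    have h1 := (tendsto_const_div_atTop_nhds_zero_nat (1 : ℝ)).mul_const (K * G + 2 * L)
    rw [zero_mul] at h1
    exact h1.eventually_lt_const (by positivity)
  have hlim := (tendsto_measure_jumpTime_deviation hchain hR0 hδ).add
    (tendsto_measure_chainNoise_deviation hμ.2.le hchain hR0 hε)
  rw [add_zero] at hlim
  obtain ⟨N₀, hN₀⟩ := exists_nat_ge C
  refine tendsto_of_tendsto_of_tendsto_of_le_of_le' tendsto_const_nhds hlim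
    (Eventually.of_forall fun _ => zero_le) ?_
  filter_upwards [hsmall, eventually_ge_atTop 1, eventually_ge_atTop N₀] with N hsm hN hNN
  -- Up to a null set, a path outside `U` forces one of the two deviations to be large.
  refine le_trans (measure_mono_ae ?_) (measure_union_le _ _)
  have h := hchain N hN
  filter_upwards [h.ae_succ_eq, h.initial, ae_clock_pos h.measurable_clock h.law_clock,
    ae_tendsto_jumpTime h.measurable_clock h.law_clock h.iIndep_clock] with ω hξ h0 hpos htop hω
  by_contra hcon
  obtain ⟨hcon1, hcon2⟩ := not_or.1 hcon
  have hJ : ∀ n ≤ ⌊R * N⌋₊, |jumpTime (σ N) n ω - n| ≤ δ * N := fun n hn =>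
    not_lt.1 fun hlt => hcon1 ⟨n, hn, hlt⟩
  have hX : ∀ n ≤ ⌊R * N⌋₊, |chainNoise τ N (fun i => ξ N i ω) n| ≤ ε * N := fun n hn =>
    not_lt.1 fun hlt => hcon2 ⟨n, hn, hlt⟩
  refine hω ⟨⟨_, isCadlag_scaledProcess hN hpos htop T⟩, hrU (lt_of_le_of_lt ?_ hρr), rfl⟩
  refine SkorokhodSpace.edist_le_of_abs_sub_le fun t => ?_
  refine (abs_scaledProcess_sub_delayedLogistic_le hτ hμ hN hT le_rfl hC hexp
    (hN₀.trans (by exact_mod_cast hNN)) hε.le (min_le_left _ _) hξ h0 hpos htop hJ hX t.2).trans ?_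
  rw [← hK, ← hG, ← hL]
  calc (ε + 1 / (N : ℝ) * K) * G + L * (δ + 2 * (1 / (N : ℝ))) =
        ε * G + L * δ + 1 / (N : ℝ) * (K * G + 2 * L) := by ring
    _ ≤ ρ := by linarith
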